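/- Fix the following conventions. For a field $k$ and $n\ge 0$, the polynomial ring $R=k[x_1,\dots,x_n]$ carries the standard grading ($\deg x_i=1$). A finitely generated $\mathbb Z$-graded $R$-module $M$ has a minimal graded free resolution $\cdots\to F_1\to F_0\to M\to 0$, i.e. a degree-preserving exact sequence in which every $F_i$ is a finitely generated graded free module and the matrices of the maps $F_{i+1}\to F_i$ have entries in $(x_1,\dots,x_n)$; the $i$-th Betti number $\beta_i(M)$ is the rank of $F_i$ in any such resolution. The codimension of $M$ is the height of its annihilator, and a nonzero finitely generated graded module $M$ is called Cohen–Macaulay of codimension $c$ if its codimension and its projective dimension are both equal to $c$. **Proposition.** (1) Let $k$ be any field and let $M$ be a (finitely generated graded) Cohen–Macaulay module of codimension $c$ over $k[x_1,\dots,x_n]$. Then there exist a field $k'$ and a nonzero graded module $M'$ of finite length over $k'[y_1,\dots,y_c]$ such that $\beta_i(M)=\beta_i(M')$ for all $i\ge 0$. (2) Consequently, for all integers $0\le c\le n$, the following two sets of sequences are equal: $$\{(\beta_i(M))_{i\ge 0} : M \text{ graded Cohen–Macaulay of codimension } c \text{ over } k[x_1,\dots,x_n] \text{ for some field } k\}$$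 and $$\{(\beta_i(M))_{i\ge 0} : M \text{ nonzero graded of finite length over } k[x_1,\dots,x_c] \text{ for some field } k\}.$$ -/

import Mathlib

open CategoryTheory

universe u

/-- A family `𝓜` of additive subgroups, indexed by `ℤ`, makes the module `M` over
`k[x_0, …, x_{n-1}]` (standard grading, every variable of degree one) a graded module:
`M` is the direct sum of the `𝓜 j`, and a form of degree `d` maps `𝓜 j` into `𝓜 (d + j)`.
(Taking `d = 0` shows that each `𝓜 j` is a `k`-subspace.) -/
structure IsGradedPolyModule (k : Type u) [Field k] (n : ℕ) {M : Type u} [AddCommGroup M]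
    [Module (MvPolynomial (Fin n) k) M] (𝓜 : ℤ → AddSubgroup M) : Prop where
  isInternal : DirectSum.IsInternal 𝓜
  smul_mem : ∀ (d : ℕ) (j : ℤ) (p : MvPolynomial (Fin n) k) (m : M),
    p.IsHomogeneous d → m ∈ 𝓜 j → p • m ∈ 𝓜 ((d : ℤ) + j)

/-- A minimal graded free resolution
`⋯ → F_2 → F_1 → F_0 → M → 0` of the graded module `M = ⨁ 𝓜 j` over `R = k[x_0, …, x_{n-1}]`.
Here `F_i` is the graded free module `⨁ⱼ R(-deg i j)` of finite rank `rank i`, whose `j`-th basis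
vector has degree `deg i j`; all maps preserve degrees; the sequence is exact; and it is
minimal: the entries of the matrices of the maps `F_{i+1} → F_i` lie in the
homogeneous maximal ideal `(x_0, …, x_{n-1})`. -/
structure MinimalGradedFreeResolution (k : Type u) [Field k] (n : ℕ) {M : Type u} [AddCommGroup M]
    [Module (MvPolynomial (Fin n) k) M] (𝓜 : ℤ → AddSubgroup M) where
  /-- the rank of `F_i` -/
  rank : ℕ → ℕ
  /-- the degrees of the basis vectors of `F_i` -/
  deg : (i : ℕ) → Fin (rank i) → ℤ
  /-- the augmentation `F_0 → M` -/
  aug : (Fin (rank 0) → MvPolynomial (Fin n) k) →ₗ[MvPolynomial (Fin n) k] M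
  /-- the differential `F_{i+1} → F_i` -/
  d : (i : ℕ) → (Fin (rank (i + 1)) → MvPolynomial (Fin n) k) →ₗ[MvPolynomial (Fin n) k]
    (Fin (rank i) → MvPolynomial (Fin n) k)
  aug_surjective : Function.Surjective aug
  exact_aug : Function.Exact (d 0) aug
  exact_d : ∀ i, Function.Exact (d (i + 1)) (d i)
  aug_mem : ∀ j, aug (Pi.single j 1) ∈ 𝓜 (deg 0 j)
  d_homogeneous : ∀ i j l, d i (Pi.single j 1) l = 0 ∨
    ∃ e : ℕ, (d i (Pi.single j 1) l).IsHomogeneous e ∧ (e : ℤ) + deg i l = deg (i + 1) j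
  minimal : ∀ i j l, d i (Pi.single j 1) l ∈
    Ideal.span (Set.range (MvPolynomial.X : Fin n → MvPolynomial (Fin n) k))

/-- `β` is the sequence of Betti numbers of the graded module `M = ⨁ 𝓜 j`: there is a minimal
graded free resolution, and in any such resolution the rank of `F_i` is `β i`. -/
def HasBettiNumbers (k : Type u) [Field k] (n : ℕ) {M : Type u} [AddCommGroup M]
    [Module (MvPolynomial (Fin n) k) M] (𝓜 : ℤ → AddSubgroup M) (β : ℕ → ℕ) : Prop :=
  Nonempty (MinimalGradedFreeResolution k n 𝓜) ∧
    ∀ F : MinimalGradedFreeResolution k n 𝓜, ∀ i, F.rank i = β i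

/-- `M` is a Cohen–Macaulay module of codimension `c` over the polynomial ring
`k[x_0, …, x_{n-1}]`: it is finitely generated, its codimension (the height of its annihilator)
is `c`, and its projective dimension equals its codimension. The zero module is
excluded, because the unit ideal has height `⊤`. -/
structure IsCohenMacaulayOfCodim (k : Type u) [Field k] (n : ℕ) (M : Type u) [AddCommGroup M]
    [Module (MvPolynomial (Fin n) k) M] (c : ℕ) : Prop where
  finite : Module.Finite (MvPolynomial (Fin n) k) M
  height_annihilator : (Module.annihilator (MvPolynomial (Fin n) k) M).height = (c : ℕ∞)
  projectiveDimension_eq :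
    projectiveDimension (ModuleCat.of (MvPolynomial (Fin n) k) M) = ((c : ℕ∞) : WithBot ℕ∞)

/-- The set of Betti sequences of graded Cohen–Macaulay modules of codimension `c` over
`k[x_0, …, x_{n-1}]`, where `k` ranges over all fields. -/
def cohenMacaulayBettiSequences (n c : ℕ) : Set (ℕ → ℕ) :=
  {β | ∃ (k : Type u) (_ : Field k) (M : Type u) (_ : AddCommGroup M)
    (_ : Module (MvPolynomial (Fin n) k) M) (𝓜 : ℤ → AddSubgroup M),
    IsGradedPolyModule k n 𝓜 ∧ IsCohenMacaulayOfCodim k n M c ∧ HasBettiNumbers k n 𝓜 β}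

/-- The set of Betti sequences of nonzero graded modules of finite length over
`k[x_0, …, x_{c-1}]`, where `k` ranges over all fields. -/
def finiteLengthBettiSequences (c : ℕ) : Set (ℕ → ℕ) :=
  {β | ∃ (k : Type u) (_ : Field k) (M : Type u) (_ : AddCommGroup M)
    (_ : Module (MvPolynomial (Fin c) k) M) (𝓜 : ℤ → AddSubgroup M),
    IsGradedPolyModule k c 𝓜 ∧ Nontrivial M ∧ IsFiniteLength (MvPolynomial (Fin c) k) M ∧
      HasBettiNumbers k c 𝓜 β}

/-!
Betti numbers of graded Cohen–Macaulay modules can be computed on modules of finite length, and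
conversely.

From a Cohen–Macaulay module `M` of codimension `c` over `R = k[x_0, …, x_{n-1}]` one passes to a
module of finite length by Artinian reduction. First the field is replaced by its algebraic closure,
which is infinite; this is a flat extension, so it keeps the minimal resolution exact
(`FreeResolution.isExactMap_of_flat`), and by going down it does not lower the height of the
annihilator (`height_le_height_of_map_le`), so the dimension of the module is still at most `n - c`.
As long as there are more than `c` variables, the resolution, whose length is at most the projective
dimension `c` (`FreeResolution.IsMinimal.rank_eq_zero_of_hasProjectiveDimensionLT`), is shorter than
the number of variables. Hence no nonzero element is killed by all the variables
(`FreeResolution.eq_zero_of_forall_X_smul_eq_zero`), so that by prime avoidance some linear form `l`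
is a nonzerodivisor on `M` (`exists_regular_linearForm`). Reducing the matrices of the resolution
modulo `l` gives the minimal resolution of `M / l M` over a polynomial ring in one variable less
(`FreeResolution.isExactMap_of_surjective`, `exists_elimination`), and the dimension drops by one
(`FreeResolution.ringKrullDim_map_le`). When `c` variables are left the dimension is zero and the
module has finite length (`FreeResolution.exists_finite_length`).

Conversely, let `M` be nonzero of finite length over `k[x_0, …, x_{c-1}]`. Its minimal resolution
has length at most `c` by Hilbert's syzygy theorem
(`FreeResolution.IsMinimal.rank_succ_eq_zero`), and at least `c` because the elements of largest
degree are killed by the variables. Adjoining variables is flat, so it yields a module with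
the same resolution, of projective dimension `c`; its annihilator lies in `(x_0, …, x_{c-1})` and
contains a power of each of these variables, so it has height `c`.

Both the syzygy theorem and the statement on elements killed by the variables are proved by
induction on the number of variables, without homological functors: the first syzygy module `Z` is
torsion-free, so the tail of the resolution reduces modulo a linear form `l` to a resolution of
`Z / l Z` in one variable less. Minimal graded resolutions exist because a generating set of
homogeneous elements of the smallest size has all its relations in the maximal ideal
(`DegreeProjections.exists_minimal_cover`), and their ranks are unique by Schanuel's lemma
(`FreeResolution.rank_eq_of_stable_equiv`).

All modules built on the way are presented by the image of a matrix under a ring homomorphism; such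
a module carries the grading of its presentation (`FreeResolution.exists_graded_map`).
-/

open MvPolynomial

/-! ### Gradings by projections -/

section IntComponent

variable {σ k : Type*} [CommRing k]

/-- The homogeneous component of a polynomial in an integral degree; it is zero in negative
degrees. -/
noncomputable def intComponent (z : ℤ) : MvPolynomial σ k →ₗ[k] MvPolynomial σ k :=
  if 0 ≤ z then homogeneousComponent z.toNat else 0

lemma intComponent_natCast (e : ℕ) (p : MvPolynomial σ k) :
    intComponent (e : ℤ) p = homogeneousComponent e p := by
  simp [intComponent]

lemma intComponent_zero_eq_C (p : MvPolynomial σ k) :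
    intComponent 0 p = C (constantCoeff p) := by
  rw [show (0 : ℤ) = ((0 : ℕ) : ℤ) from rfl, intComponent_natCast, homogeneousComponent_zero]
  rfl

lemma intComponent_of_neg {z : ℤ} (hz : z < 0) (p : MvPolynomial σ k) : intComponent z p = 0 := by
  simp [intComponent, not_le.2 hz]

lemma intComponent_of_isHomogeneous {e : ℕ} {p : MvPolynomial σ k} (hp : p.IsHomogeneous e)
    (z : ℤ) : intComponent z p = if z = e then p else 0 := by
  rcases lt_or_ge z 0 with hz | hz
  · rw [intComponent_of_neg hz, if_neg (by omega)]
  · lift z to ℕ using hz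
    rw [intComponent_natCast, homogeneousComponent_of_mem hp]
    simp [eq_comm]

lemma intComponent_eq_self_iff {z : ℤ} {p : MvPolynomial σ k} :
    intComponent z p = p ↔ p = 0 ∨ ∃ e : ℕ, p.IsHomogeneous e ∧ (e : ℤ) = z := by
  constructor
  · intro h
    rcases lt_or_ge z 0 with hz | hz
    · left; rw [← h, intComponent_of_neg hz]
    · lift z to ℕ using hz
      refine Or.inr ⟨z, ?_, rfl⟩
      rw [← h, intComponent_natCast]
      exact homogeneousComponent_isHomogeneous z p
  · rintro (rfl | ⟨e, he, rfl⟩)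
    · simp
    · simp [intComponent_of_isHomogeneous he]

lemma intComponent_intComponent (z w : ℤ) (p : MvPolynomial σ k) :
    intComponent z (intComponent w p) = if z = w then intComponent w p else 0 := by
  rcases lt_or_ge w 0 with hw | hw
  · simp [intComponent_of_neg hw]
  · lift w to ℕ using hw
    rw [intComponent_natCast]
    exact intComponent_of_isHomogeneous (homogeneousComponent_isHomogeneous w p) z

lemma intComponent_mul {e : ℕ} {p : MvPolynomial σ k} (hp : p.IsHomogeneous e) (z : ℤ)
    (q : MvPolynomial σ k) : intComponent (e + z) (p * q) = p * intComponent z q := by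
  conv_lhs => rw [← sum_homogeneousComponent q]
  conv_rhs => rw [← sum_homogeneousComponent q]
  simp only [Finset.mul_sum, map_sum]
  refine Finset.sum_congr rfl fun i _ => ?_
  have hi := homogeneousComponent_isHomogeneous i q
  rw [intComponent_of_isHomogeneous (hp.mul hi), intComponent_of_isHomogeneous hi]
  by_cases h : z = i
  · simp [h]
  · rw [if_neg (by push_cast; omega), if_neg h, mul_zero]

lemma exists_sum_intComponent (p : MvPolynomial σ k) :
    ∃ s : Finset ℤ, ∀ t : Finset ℤ, s ⊆ t → ∑ z ∈ t, intComponent z p = p := by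
  refine ⟨(Finset.range (p.totalDegree + 1)).map Nat.castEmbedding, fun t ht => ?_⟩
  rw [← Finset.sum_subset ht, Finset.sum_map]
  · conv_rhs => rw [← sum_homogeneousComponent p]
    exact Finset.sum_congr rfl fun i _ => intComponent_natCast i p
  · intro z _ hz
    rcases lt_or_ge z 0 with h | h
    · exact intComponent_of_neg h p
    · lift z to ℕ using h
      rw [intComponent_natCast, homogeneousComponent_eq_zero]
      by_contra hlt
      exact hz (by simp; omega)

end IntComponent

/-- A grading of a module over `k[x_0, …, x_{n-1}]`, given by the projections onto its graded
pieces: these are orthogonal idempotents summing to the identity, and multiplication by a form of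
degree `e` shifts degrees by `e`. -/
structure DegreeProjections (k : Type u) [Field k] (n : ℕ) (N : Type u) [AddCommGroup N]
    [Module (MvPolynomial (Fin n) k) N] where
  /-- the projection onto the piece of degree `j` -/
  proj : ℤ → N →+ N
  proj_proj : ∀ i j m, proj i (proj j m) = if i = j then proj j m else 0
  exists_sum : ∀ m, ∃ s : Finset ℤ, ∑ j ∈ s, proj j m = m
  proj_smul : ∀ (e : ℕ) (j : ℤ) (p : MvPolynomial (Fin n) k) (m : N), p.IsHomogeneous e →
    proj (e + j) (p • m) = p • proj j m

section Grading

variable {k : Type u} [Field k] {n : ℕ} {N : Type u} [AddCommGroup N]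
  [Module (MvPolynomial (Fin n) k) N]

namespace DegreeProjections

variable (G : DegreeProjections k n N)

lemma proj_smul_of_proj_eq_self {i : ℤ} {m : N} (hm : G.proj i m = m) (D : ℤ)
    (p : MvPolynomial (Fin n) k) : G.proj D (p • m) = intComponent (D - i) p • m := by
  conv_lhs => rw [← sum_homogeneousComponent p]
  conv_rhs => rw [← sum_homogeneousComponent p]
  simp only [Finset.sum_smul, map_sum]
  refine Finset.sum_congr rfl fun e _ => ?_
  have he := homogeneousComponent_isHomogeneous e p
  have h := G.proj_smul e i _ m he
  rw [hm] at h
  rw [← h, G.proj_proj, h, intComponent_of_isHomogeneous he]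
  by_cases hD : D = e + i
  · rw [if_pos hD, if_pos (by omega)]
  · rw [if_neg hD, if_neg (by omega), zero_smul]

/-- The graded pieces cut out by the projections form a graded module. -/
lemma isGradedPolyModule : IsGradedPolyModule k n fun j => (G.proj j).range where
  isInternal := by
    classical
    have hmem : ∀ j m, m ∈ (G.proj j).range ↔ G.proj j m = m := by
      intro j m
      refine ⟨?_, fun h => ⟨m, h⟩⟩
      rintro ⟨x, rfl⟩
      rw [G.proj_proj, if_pos rfl]
    constructor
    · rw [injective_iff_map_eq_zero]
      intro x hx
      ext j
      have key : ∀ y : DirectSum ℤ fun j => (G.proj j).range,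
          G.proj j (DirectSum.coeAddMonoidHom (fun j => (G.proj j).range) y) = (y j : N) := by
        intro y
        induction y using DirectSum.induction_on with
        | zero => simp
        | of i y =>
          rw [DirectSum.coeAddMonoidHom_of, ← (hmem i y).1 y.2, G.proj_proj]
          by_cases h : j = i
          · subst h
            rw [if_pos rfl, DirectSum.of_eq_same, (hmem j y).1 y.2]
          · rw [if_neg h, DirectSum.of_eq_of_ne _ _ _ h]; rfl
        | add x y hx hy => simp [hx, hy]
      rw [← key, hx]
      simp
    · intro m
      obtain ⟨s, hs⟩ := G.exists_sum m
      refine ⟨∑ j ∈ s, DirectSum.of (fun j => (G.proj j).range) j ⟨G.proj j m, m, rfl⟩, ?_⟩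
      rw [map_sum]
      simpa using hs
  smul_mem := by
    rintro d j p _ hp ⟨m, rfl⟩
    exact ⟨p • m, G.proj_smul d j p m hp⟩

end DegreeProjections

/-- The projections onto the pieces of a graded module. -/
lemma IsGradedPolyModule.exists_degreeProjections {𝓜 : ℤ → AddSubgroup N}
    (h : IsGradedPolyModule k n 𝓜) :
    ∃ G : DegreeProjections k n N, ∀ j m, m ∈ 𝓜 j ↔ G.proj j m = m := by
  classical
  let E := AddEquiv.ofBijective _ h.isInternal
  have hE : ∀ j (m : 𝓜 j), E (DirectSum.of (fun j => 𝓜 j) j m) = m := fun j m =>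
    DirectSum.coeAddMonoidHom_of 𝓜 j m
  have hE' : ∀ j (m : N) (hm : m ∈ 𝓜 j), E.symm m = DirectSum.of (fun j => 𝓜 j) j ⟨m, hm⟩ := by
    intro j m hm
    rw [AddEquiv.symm_apply_eq, hE]
  let P : ℤ → N →+ N := fun j => (𝓜 j).subtype.comp
    ((DFinsupp.evalAddMonoidHom (β := fun j => 𝓜 j) j).comp E.symm.toAddMonoidHom)
  have hP : ∀ j m, P j m = (E.symm m j : N) := fun j m => rfl
  have hmemP : ∀ j m, P j m ∈ 𝓜 j := fun j m => (E.symm m j).2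
  have hPof : ∀ i j m, m ∈ 𝓜 j → P i m = if i = j then m else 0 := by
    intro i j m hm
    rw [hP, hE' j m hm]
    by_cases hij : i = j
    · subst hij
      rw [if_pos rfl, DirectSum.of_eq_same]
    · rw [if_neg hij, DirectSum.of_eq_of_ne _ _ _ hij]; rfl
  have hsum : ∀ m, ∃ s : Finset ℤ, ∑ j ∈ s, P j m = m := by
    intro m
    refine ⟨DFinsupp.support (E.symm m), ?_⟩
    conv_rhs => rw [← E.apply_symm_apply m, ← DirectSum.sum_support_of (E.symm m), map_sum]
    exact Finset.sum_congr rfl fun j _ => by rw [hE, hP]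
  refine ⟨⟨P, fun i j m => hPof i j _ (hmemP j m), hsum, ?_⟩,
    fun j m => ⟨fun hm => ?_, fun hm => ?_⟩⟩
  · intro e j p m hp
    obtain ⟨s, hs⟩ := hsum m
    conv_lhs => rw [← hs, Finset.smul_sum, map_sum]
    have : ∀ i ∈ s, P (e + j) (p • P i m) = if i = j then p • P j m else 0 := by
      intro i _
      rw [hPof _ _ _ (h.smul_mem e i p _ hp (hmemP i m))]
      by_cases hij : i = j
      · subst hij; simp
      · rw [if_neg (by omega), if_neg hij]
    rw [Finset.sum_congr rfl this, Finset.sum_ite_eq']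
    split_ifs with hj
    · rfl
    · have h0 : P j m = 0 := by
        conv_lhs => rw [← hs, map_sum]
        refine Finset.sum_eq_zero fun i hi => ?_
        rw [hPof j i _ (hmemP i m), if_neg]
        rintro rfl
        exact hj hi
      rw [h0, smul_zero]
  · exact (hPof j j m hm).trans (if_pos rfl)
  · rw [← hm]; exact hmemP j m

end Grading

/-! ### Existence of minimal graded free resolutions -/

section GradedFree

variable {k : Type u} [Field k] {n : ℕ}

lemma mem_span_range_X_iff {σ : Type*} {p : MvPolynomial σ k} :
    p ∈ Ideal.span (Set.range (X : σ → MvPolynomial σ k)) ↔ constantCoeff p = 0 := by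
  have h := mem_pow_idealOfVars_iff' (σ := σ) 1 p
  rw [pow_one] at h
  rw [h]
  refine ⟨fun h => h 0 (by simp), fun h x hx => ?_⟩
  obtain rfl : x = 0 := (Finsupp.degree_eq_zero_iff x).1 (by omega)
  exact h

/-- The grading of the free module `⨁ⱼ R(-deg j)`, whose `j`-th basis vector has degree `deg j`. -/
noncomputable def freeProjections {r : ℕ} (deg : Fin r → ℤ) :
    DegreeProjections k n (Fin r → MvPolynomial (Fin n) k) where
  proj D :=
    { toFun := fun v i => intComponent (D - deg i) (v i)
      map_zero' := by ext1; simp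
      map_add' := fun v w => by ext1; simp }
  proj_proj D E v := by
    ext1 i
    simp only [AddMonoidHom.coe_mk, ZeroHom.coe_mk, intComponent_intComponent]
    by_cases h : D = E
    · simp [h]
    · rw [if_neg (by omega), if_neg h]; rfl
  exists_sum v := by
    classical
    choose s hs using fun i => exists_sum_intComponent (v i)
    refine ⟨Finset.univ.biUnion fun i => (s i).map (addRightEmbedding (deg i)), ?_⟩
    ext1 i
    rw [Finset.sum_apply]
    conv_rhs => rw [← hs i ((Finset.univ.biUnion fun i =>
      (s i).map (addRightEmbedding (deg i))).map (addRightEmbedding (-deg i))) (by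
        intro z hz
        simp only [Finset.mem_map, Finset.mem_biUnion, Finset.mem_univ, true_and,
          addRightEmbedding_apply]
        exact ⟨z + deg i, ⟨i, z, hz, rfl⟩, by ring⟩)]
    rw [Finset.sum_map]
    rfl
  proj_smul e j p v hp := by
    ext1 i
    simp only [AddMonoidHom.coe_mk, ZeroHom.coe_mk, Pi.smul_apply, smul_eq_mul]
    rw [← intComponent_mul hp, add_sub_assoc]

lemma freeProjections_apply {r : ℕ} (deg : Fin r → ℤ) (D : ℤ) (v : Fin r → MvPolynomial (Fin n) k)
    (i : Fin r) : (freeProjections deg).proj D v i = intComponent (D - deg i) (v i) := rfl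

lemma LinearMap.apply_eq_sum_single {R N : Type*} [CommRing R] [AddCommGroup N] [Module R N]
    {ι : Type*} [Fintype ι] [DecidableEq ι] (g : (ι → R) →ₗ[R] N) (v : ι → R) :
    g v = ∑ j, v j • g (Pi.single j 1) := by
  conv_lhs => rw [pi_eq_sum_univ' v, map_sum]
  refine Finset.sum_congr rfl fun j _ => ?_
  rw [map_smul]

variable {N : Type u} [AddCommGroup N] [Module (MvPolynomial (Fin n) k) N]

namespace DegreeProjections

variable (G : DegreeProjections k n N)

/-- A map out of a graded free module that sends each basis vector to an element of the same
degree preserves degrees. -/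
lemma proj_map_free {r : ℕ} {deg : Fin r → ℤ}
    {g : (Fin r → MvPolynomial (Fin n) k) →ₗ[MvPolynomial (Fin n) k] N}
    (hg : ∀ j, G.proj (deg j) (g (Pi.single j 1)) = g (Pi.single j 1)) (D : ℤ)
    (v : Fin r → MvPolynomial (Fin n) k) :
    G.proj D (g v) = g ((freeProjections deg).proj D v) := by
  rw [g.apply_eq_sum_single, map_sum, g.apply_eq_sum_single ((freeProjections deg).proj D v)]
  exact Finset.sum_congr rfl fun j _ => G.proj_smul_of_proj_eq_self (hg j) D (v j)

/-- The grading induced on the quotient by a graded submodule. -/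
noncomputable def quotient (K : Submodule (MvPolynomial (Fin n) k) N)
    (hK : ∀ j, ∀ m ∈ K, G.proj j m ∈ K) : DegreeProjections k n (N ⧸ K) where
  proj j := QuotientAddGroup.map K.toAddSubgroup K.toAddSubgroup (G.proj j) fun m hm => hK j m hm
  proj_proj i j m := by
    obtain ⟨m, rfl⟩ := K.mkQ_surjective m
    change K.mkQ (G.proj i (G.proj j m)) = if i = j then K.mkQ (G.proj j m) else 0
    rw [G.proj_proj]
    split_ifs <;> simp
  exists_sum m := by
    obtain ⟨m, rfl⟩ := K.mkQ_surjective m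
    obtain ⟨s, hs⟩ := G.exists_sum m
    refine ⟨s, ?_⟩
    change ∑ j ∈ s, K.mkQ (G.proj j m) = K.mkQ m
    rw [← map_sum, hs]
  proj_smul e j p m hp := by
    obtain ⟨m, rfl⟩ := K.mkQ_surjective m
    change K.mkQ (G.proj (e + j) (p • m)) = p • K.mkQ (G.proj j m)
    rw [G.proj_smul e j p m hp, map_smul]

/-- A finitely generated graded submodule `K` is covered, preserving degrees, by a graded free
module of finite rank such that the kernel of the cover lies in `(x_0, …, x_{n-1})` times the free
module. Homogeneous generators of the smallest possible number do this: a relation with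
an invertible coefficient would express one of them through the others. -/
lemma exists_minimal_cover (K : Submodule (MvPolynomial (Fin n) k) N) (hfg : K.FG)
    (hK : ∀ j, ∀ m ∈ K, G.proj j m ∈ K) :
    ∃ (r : ℕ) (deg : Fin r → ℤ)
      (g : (Fin r → MvPolynomial (Fin n) k) →ₗ[MvPolynomial (Fin n) k] N),
      LinearMap.range g = K ∧ (∀ j, G.proj (deg j) (g (Pi.single j 1)) = g (Pi.single j 1)) ∧
      ∀ v, g v = 0 → ∀ j, constantCoeff (v j) = 0 := by
  classical
  have hex : ∃ r : ℕ, ∃ (deg : Fin r → ℤ) (a : Fin r → N),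
      (∀ j, G.proj (deg j) (a j) = a j) ∧
        Submodule.span (MvPolynomial (Fin n) k) (Set.range a) = K := by
    obtain ⟨S, hS⟩ := hfg
    choose t ht using G.exists_sum
    let T := S.sigma fun m => t m
    refine ⟨T.card, fun i => (T.equivFin.symm i).1.2,
      fun i => G.proj (T.equivFin.symm i).1.2 (T.equivFin.symm i).1.1, fun j => ?_, ?_⟩
    · rw [G.proj_proj, if_pos rfl]
    · apply le_antisymm
      · rw [Submodule.span_le]
        rintro _ ⟨i, rfl⟩
        refine hK _ _ (hS ▸ Submodule.subset_span ?_)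
        exact (Finset.mem_sigma.1 (T.equivFin.symm i).2).1
      · rw [← hS, Submodule.span_le]
        intro m hm
        rw [SetLike.mem_coe, ← ht m]
        refine sum_mem fun j hj => Submodule.subset_span ?_
        refine ⟨T.equivFin ⟨⟨m, j⟩, Finset.mem_sigma.2 ⟨hm, hj⟩⟩, ?_⟩
        simp
  obtain ⟨deg, a, ha, hspan⟩ := Nat.find_spec hex
  have hmin := fun r' (hr' : r' < Nat.find hex) => Nat.find_min hex hr'
  generalize Nat.find hex = r at deg a ha hspan hmin
  have hga : ∀ j, Fintype.linearCombination (MvPolynomial (Fin n) k) a (Pi.single j 1) = a j :=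
    fun j => by rw [Fintype.linearCombination_apply_single, one_smul]
  refine ⟨r, deg, Fintype.linearCombination _ a, ?_, fun j => by rw [hga, ha], ?_⟩
  · rw [Fintype.range_linearCombination, hspan]
  · intro v hv j
    by_contra hc
    obtain ⟨r, rfl⟩ : ∃ s, r = s + 1 := ⟨r - 1, by have := j.pos; omega⟩
    refine hmin r (Nat.lt_succ_self r) ⟨deg ∘ j.succAbove, a ∘ j.succAbove, fun i => ha _, ?_⟩
    rw [← hspan]
    apply le_antisymm (Submodule.span_mono (Set.range_comp_subset_range _ _))
    rw [Submodule.span_le]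
    -- the component in degree `deg j` of the relation `v` has the unit `constantCoeff (v j)` as
    -- its coefficient at `a j`
    have h0 : ∑ i, intComponent (deg j - deg i) (v i) • a i = 0 := by
      have := G.proj_map_free (g := Fintype.linearCombination (MvPolynomial (Fin n) k) a)
        (fun i => by rw [hga, ha i]) (deg j) v
      rw [hv, map_zero, Fintype.linearCombination_apply] at this
      exact this.symm
    rw [Fin.sum_univ_succAbove _ j, sub_self, intComponent_zero_eq_C] at h0
    have hj : a j ∈ Submodule.span (MvPolynomial (Fin n) k) (Set.range (a ∘ j.succAbove)) := by
      have h1 : a j = (C (constantCoeff (v j))⁻¹ : MvPolynomial (Fin n) k) •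
          ((C (constantCoeff (v j)) : MvPolynomial (Fin n) k) • a j) := by
        rw [smul_smul, ← C_mul, inv_mul_cancel₀ hc, C_1, one_smul]
      rw [h1, eq_neg_of_add_eq_zero_left h0]
      refine Submodule.smul_mem _ _ (neg_mem (sum_mem fun i _ => Submodule.smul_mem _ _ ?_))
      exact Submodule.subset_span ⟨i, rfl⟩
    rintro _ ⟨i, rfl⟩
    rcases Fin.eq_self_or_eq_succAbove j i with rfl | ⟨i, rfl⟩
    · exact hj
    · exact Submodule.subset_span ⟨i, rfl⟩

end DegreeProjections

/-- A graded submodule of a graded free module of finite rank. -/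
structure GradedFreeSubmodule (k : Type u) [Field k] (n : ℕ) where
  /-- the rank of the ambient free module -/
  rank : ℕ
  /-- the degrees of its basis vectors -/
  deg : Fin rank → ℤ
  /-- the submodule -/
  carrier : Submodule (MvPolynomial (Fin n) k) (Fin rank → MvPolynomial (Fin n) k)
  proj_mem : ∀ j, ∀ m ∈ carrier, (freeProjections deg).proj j m ∈ carrier

lemma GradedFreeSubmodule.exists_next (K : GradedFreeSubmodule k n) :
    ∃ (L : GradedFreeSubmodule k n)
      (g : (Fin L.rank → MvPolynomial (Fin n) k) →ₗ[MvPolynomial (Fin n) k]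
        (Fin K.rank → MvPolynomial (Fin n) k)),
      LinearMap.range g = K.carrier ∧ LinearMap.ker g = L.carrier ∧
      (∀ j, (freeProjections K.deg).proj (L.deg j) (g (Pi.single j 1)) = g (Pi.single j 1)) ∧
      ∀ v ∈ L.carrier, ∀ j, constantCoeff (v j) = 0 := by
  obtain ⟨r, deg, g, hr, hd, hk⟩ := (freeProjections K.deg).exists_minimal_cover K.carrier
    (IsNoetherian.noetherian _) K.proj_mem
  refine ⟨⟨r, deg, LinearMap.ker g, fun j m hm => ?_⟩, g, hr, rfl, hd, fun v hv => hk v hv⟩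
  rw [LinearMap.mem_ker] at hm ⊢
  rw [← (freeProjections K.deg).proj_map_free hd, hm, map_zero]

/-- Every finitely generated graded module has a minimal graded free resolution. -/
theorem IsGradedPolyModule.nonempty_minimalGradedFreeResolution {𝓜 : ℤ → AddSubgroup N}
    (h : IsGradedPolyModule k n 𝓜) [Module.Finite (MvPolynomial (Fin n) k) N] :
    Nonempty (MinimalGradedFreeResolution k n 𝓜) := by
  obtain ⟨G, hG⟩ := h.exists_degreeProjections
  obtain ⟨r, deg, g, hr, hd, hk⟩ := G.exists_minimal_cover ⊤ Module.Finite.fg_top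
    (fun _ _ _ => trivial)
  let K₀ : GradedFreeSubmodule k n := ⟨r, deg, LinearMap.ker g, fun j m hm => by
    rw [LinearMap.mem_ker] at hm ⊢
    rw [← G.proj_map_free hd, hm, map_zero]⟩
  choose next d hrange hker hdeg hmin using GradedFreeSubmodule.exists_next (k := k) (n := n)
  let K : ℕ → GradedFreeSubmodule k n := fun i => Nat.rec K₀ (fun _ L => next L) i
  have hK : ∀ i, ∀ v ∈ (K i).carrier, ∀ j, constantCoeff (v j) = 0 := by
    rintro (_ | i)
    · exact fun v hv => hk v hv
    · exact hmin (K i)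
  exact ⟨{
    rank := fun i => (K i).rank
    deg := fun i => (K i).deg
    aug := g
    d := fun i => d (K i)
    aug_surjective := LinearMap.range_eq_top.1 hr
    exact_aug := LinearMap.exact_iff.2 (hrange K₀).symm
    exact_d := fun i => LinearMap.exact_iff.2 ((hker (K i)).trans (hrange (K (i + 1))).symm)
    aug_mem := fun j => (hG _ _).2 (hd j)
    d_homogeneous := fun i j l => by
      have := congrFun (hdeg (K i) j) l
      rw [freeProjections_apply, intComponent_eq_self_iff] at this
      rcases this with h | ⟨e, he, h⟩
      · exact Or.inl h
      · exact Or.inr ⟨e, he, eq_sub_iff_add_eq.1 h⟩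
    minimal := fun i j l => mem_span_range_X_iff.2
      (hK i _ (hrange (K i) ▸ LinearMap.mem_range_self _ _) l) }⟩

end GradedFree

/-! ### Free resolutions and their syzygies -/

/-- A resolution of the module `M` by free modules of finite rank, without gradings. -/
structure FreeResolution (R : Type u) [CommRing R] (M : Type u) [AddCommGroup M] [Module R M] where
  /-- the rank of `F_i` -/
  rank : ℕ → ℕ
  /-- the differential `F_{i+1} → F_i` -/
  d : (i : ℕ) → (Fin (rank (i + 1)) → R) →ₗ[R] (Fin (rank i) → R)
  /-- the augmentation `F_0 → M` -/
  aug : (Fin (rank 0) → R) →ₗ[R] M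
  aug_surjective : Function.Surjective aug
  exact_aug : Function.Exact (d 0) aug
  exact_d : ∀ i, Function.Exact (d (i + 1)) (d i)

namespace FreeResolution

variable {R : Type u} [CommRing R] {M : Type u} [AddCommGroup M] [Module R M]

/-- The resolution of the first syzygy module obtained by deleting `F_0`. -/
def shift (F : FreeResolution R M) : FreeResolution R (LinearMap.range (F.d 0)) where
  rank i := F.rank (i + 1)
  d i := F.d (i + 1)
  aug := (F.d 0).rangeRestrict
  aug_surjective := (F.d 0).surjective_rangeRestrict
  exact_aug x := by rw [← F.exact_d 0 x, ← Subtype.val_inj]; rfl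
  exact_d i := F.exact_d (i + 1)

/-- The entries of the matrices of the differentials lie in the ideal `I`. -/
def IsMinimal (F : FreeResolution R M) (I : Ideal R) : Prop :=
  ∀ i j l, F.d i (Pi.single j 1) l ∈ I

section Minimal

variable {F : FreeResolution R M} {I : Ideal R}

lemma IsMinimal.shift (h : F.IsMinimal I) : F.shift.IsMinimal I := fun i => h (i + 1)

lemma IsMinimal.d_apply_mem (h : F.IsMinimal I) (i : ℕ) (v : Fin (F.rank (i + 1)) → R)
    (l : Fin (F.rank i)) : F.d i v l ∈ I := by
  rw [(F.d i).apply_eq_sum_single, Finset.sum_apply]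
  exact sum_mem fun j _ => I.mul_mem_left _ (h i j l)

lemma IsMinimal.rank_eq_zero_of_surjective (h : F.IsMinimal I) (hI : I ≠ ⊤) {i : ℕ}
    (hs : Function.Surjective (F.d i)) : F.rank i = 0 := by
  by_contra hne
  obtain ⟨v, hv⟩ := hs (Pi.single ⟨0, Nat.pos_of_ne_zero hne⟩ 1)
  refine hI ((Ideal.eq_top_iff_one I).2 ?_)
  have := h.d_apply_mem i v ⟨0, Nat.pos_of_ne_zero hne⟩
  rwa [hv, Pi.single_eq_same] at this

lemma IsMinimal.rank_zero_eq_zero (h : F.IsMinimal I) (hI : I ≠ ⊤) [Subsingleton M] :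
    F.rank 0 = 0 :=
  h.rank_eq_zero_of_surjective hI fun x => (F.exact_aug x).1 (Subsingleton.elim _ _)

lemma IsMinimal.rank_succ_eq_zero_of_d_eq_zero (h : F.IsMinimal I) (hI : I ≠ ⊤) {i : ℕ}
    (hi : F.d i = 0) : F.rank (i + 1) = 0 :=
  h.rank_eq_zero_of_surjective hI fun x => (F.exact_d i x).1 (by rw [hi]; rfl)

lemma IsMinimal.rank_eq_zero_of_le (h : F.IsMinimal I) (hI : I ≠ ⊤) {i j : ℕ}
    (hi : F.rank i = 0) (hij : i ≤ j) : F.rank j = 0 := by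
  induction j, hij using Nat.le_induction with
  | base => exact hi
  | succ j _ hj =>
    refine h.rank_succ_eq_zero_of_d_eq_zero hI ?_
    ext x l
    exact (Fin.cast hj l).elim0

lemma subsingleton_of_rank_eq_zero (F : FreeResolution R M) (h : F.rank 0 = 0) :
    Subsingleton M := by
  have : IsEmpty (Fin (F.rank 0)) := by rw [h]; infer_instance
  exact F.aug_surjective.subsingleton

end Minimal

end FreeResolution

/-! ### Uniqueness of the ranks in minimal resolutions -/

section Uniqueness

variable {R : Type u} [CommRing R]

/-- If the kernel of `p : P → X` consists of vectors with coordinates in a maximal ideal `I`, then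
no free module covering `X` has smaller rank than `P`: the composite `P → Q → P` of lifts of the
identity of `X` is the identity modulo `I`. -/
lemma finrank_le_finrank_of_minimal_cover {P Q X : Type*} [AddCommGroup P] [Module R P]
    [AddCommGroup Q] [Module R Q] [AddCommGroup X] [Module R X] [Module.Free R P]
    [Module.Finite R P] [Module.Free R Q] [Module.Finite R Q] {I : Ideal R} (hI : I.IsMaximal)
    {p : P →ₗ[R] X} {q : Q →ₗ[R] X} (hp : Function.Surjective p) (hq : Function.Surjective q)
    (hmin : ∀ v, p v = 0 → ∀ f : P →ₗ[R] R, f v ∈ I) :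
    Module.finrank R P ≤ Module.finrank R Q := by
  classical
  have : Nontrivial R := by
    by_contra h
    rw [not_nontrivial_iff_subsingleton] at h
    exact hI.ne_top (Subsingleton.elim _ _)
  let : Field (R ⧸ I) := Ideal.Quotient.field I
  obtain ⟨a, ha⟩ := Module.projective_lifting_property q p hq
  obtain ⟨b, hb⟩ := Module.projective_lifting_property p q hp
  let bP := Module.finBasis R P
  let bQ := Module.finBasis R Q
  have key : ((LinearMap.toMatrix bQ bP b).map (Ideal.Quotient.mk I)) *
      ((LinearMap.toMatrix bP bQ a).map (Ideal.Quotient.mk I)) = 1 := by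
    rw [← Matrix.map_mul, ← LinearMap.toMatrix_comp]
    have h1 : (1 : Matrix (Fin (Module.finrank R P)) (Fin (Module.finrank R P)) (R ⧸ I)) =
        (LinearMap.toMatrix bP bP LinearMap.id).map (Ideal.Quotient.mk I) := by
      rw [LinearMap.toMatrix_id, Matrix.map_one _ (map_zero _) (map_one _)]
    rw [h1]
    ext i j
    rw [Matrix.map_apply, Matrix.map_apply, Ideal.Quotient.eq, LinearMap.toMatrix_apply,
      LinearMap.toMatrix_apply, ← Finsupp.sub_apply, ← map_sub]
    refine hmin _ ?_ (bP.coord i)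
    have h2 : p (b (a (bP j))) = p (bP j) := by
      rw [← LinearMap.comp_apply p b, hb, ← LinearMap.comp_apply q a, ha]
    rw [LinearMap.comp_apply, map_sub, h2, LinearMap.id_apply, sub_self]
  have hr := Matrix.rank_mul_le_right ((LinearMap.toMatrix bQ bP b).map (Ideal.Quotient.mk I))
      ((LinearMap.toMatrix bP bQ a).map (Ideal.Quotient.mk I))
  rw [key, Matrix.rank_one] at hr
  simpa using hr.trans (Matrix.rank_le_card_height _)

/-- **Schanuel's lemma**. -/
lemma nonempty_schanuel_equiv {P Q X : Type*} [AddCommGroup P] [Module R P]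
    [AddCommGroup Q] [Module R Q] [AddCommGroup X] [Module R X] [Module.Projective R P]
    [Module.Projective R Q] {p : P →ₗ[R] X} {q : Q →ₗ[R] X} (hp : Function.Surjective p)
    (hq : Function.Surjective q) :
    Nonempty ((LinearMap.ker p × Q) ≃ₗ[R] (LinearMap.ker q × P)) := by
  obtain ⟨a, ha⟩ := Module.projective_lifting_property q p hq
  obtain ⟨b, hb⟩ := Module.projective_lifting_property p q hp
  have ha' : ∀ x, q (a x) = p x := fun x => LinearMap.congr_fun ha x
  have hb' : ∀ x, p (b x) = q x := fun x => LinearMap.congr_fun hb x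
  -- both sides are isomorphic to `{(x, y) | p x = q y}`, by subtracting `b y`, respectively `a x`
  refine ⟨LinearEquiv.ofLinearMap
    ((LinearMap.codRestrict (LinearMap.ker q)
      (LinearMap.snd R _ _ - a ∘ₗ ((LinearMap.ker p).subtype ∘ₗ LinearMap.fst R _ _ +
        b ∘ₗ LinearMap.snd R _ _)) ?_).prod
      ((LinearMap.ker p).subtype ∘ₗ LinearMap.fst R _ _ + b ∘ₗ LinearMap.snd R _ _))
    ((LinearMap.codRestrict (LinearMap.ker p)
      (LinearMap.snd R _ _ - b ∘ₗ ((LinearMap.ker q).subtype ∘ₗ LinearMap.fst R _ _ +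
        a ∘ₗ LinearMap.snd R _ _)) ?_).prod
      ((LinearMap.ker q).subtype ∘ₗ LinearMap.fst R _ _ + a ∘ₗ LinearMap.snd R _ _))
    ?_ ?_⟩
  · rintro ⟨⟨x, hx⟩, y⟩
    simp [ha', hb', LinearMap.mem_ker.1 hx]
  · rintro ⟨⟨x, hx⟩, y⟩
    simp [ha', hb', LinearMap.mem_ker.1 hx]
  · refine LinearMap.ext ?_
    rintro ⟨⟨x, hx⟩, y⟩
    refine Prod.ext (Subtype.ext ?_) ?_ <;> simp
  · refine LinearMap.ext ?_
    rintro ⟨⟨x, hx⟩, y⟩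
    refine Prod.ext (Subtype.ext ?_) ?_ <;> simp

namespace FreeResolution

variable {M M' : Type u} [AddCommGroup M] [Module R M] [AddCommGroup M'] [Module R M']

lemma finrank_le_of_minimal_cover_prod {F : FreeResolution R M} {I : Ideal R} (hI : I.IsMaximal)
    (hF : F.IsMinimal I) {A Q : Type u} [AddCommGroup A] [Module R A] [Module.Free R A]
    [Module.Finite R A] [AddCommGroup Q] [Module R Q] [Module.Free R Q] [Module.Finite R Q]
    {q : Q →ₗ[R] M × A} (hq : Function.Surjective q) :
    Module.finrank R ((Fin (F.rank 0) → R) × A) ≤ Module.finrank R Q := by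
  refine finrank_le_finrank_of_minimal_cover hI
    (p := F.aug.prodMap (LinearMap.id : A →ₗ[R] A)) (Prod.map_surjective.2 ⟨F.aug_surjective,
      Function.surjective_id⟩) hq ?_
  rintro ⟨v, w⟩ hv f
  obtain ⟨hv', rfl⟩ : F.aug v = 0 ∧ w = 0 := by simpa using hv
  obtain ⟨u, rfl⟩ := (F.exact_aug v).1 hv'
  have := (f ∘ₗ LinearMap.inl R _ A).apply_eq_sum_single (F.d 0 u)
  rw [LinearMap.comp_apply, LinearMap.inl_apply] at this
  rw [this]
  exact sum_mem fun j _ => I.mul_mem_right _ (hF.d_apply_mem 0 u j)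

/-- The ranks in a minimal free resolution are unchanged when the module is replaced by a stably
isomorphic one; by Schanuel's lemma the syzygies of stably isomorphic modules are again stably
isomorphic. -/
theorem rank_eq_of_stable_equiv {I : Ideal R} (hI : I.IsMaximal) (i : ℕ) :
    ∀ {M M' : Type u} [AddCommGroup M] [Module R M] [AddCommGroup M'] [Module R M']
      {F : FreeResolution R M} {F' : FreeResolution R M'}, F.IsMinimal I → F'.IsMinimal I →
      ∀ {A A' : Type u} [AddCommGroup A] [Module R A] [Module.Free R A] [Module.Finite R A]
        [AddCommGroup A'] [Module R A'] [Module.Free R A'] [Module.Finite R A'],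
        Module.finrank R A = Module.finrank R A' → ((M × A) ≃ₗ[R] (M' × A')) →
        F.rank i = F'.rank i := by
  have : Nontrivial R := by
    by_contra h
    rw [not_nontrivial_iff_subsingleton] at h
    exact hI.ne_top (Subsingleton.elim _ _)
  have h0 : ∀ {M M' : Type u} [AddCommGroup M] [Module R M] [AddCommGroup M'] [Module R M']
      {F : FreeResolution R M} {F' : FreeResolution R M'}, F.IsMinimal I → F'.IsMinimal I →
      ∀ {A A' : Type u} [AddCommGroup A] [Module R A] [Module.Free R A] [Module.Finite R A]
        [AddCommGroup A'] [Module R A'] [Module.Free R A'] [Module.Finite R A'],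
        Module.finrank R A = Module.finrank R A' → ((M × A) ≃ₗ[R] (M' × A')) →
        F.rank 0 ≤ F'.rank 0 := by
    intro M M' _ _ _ _ F F' hF hF' A A' _ _ _ _ _ _ _ _ hA e
    have := finrank_le_of_minimal_cover_prod hI hF (A := A)
      (q := e.symm.toLinearMap ∘ₗ F'.aug.prodMap (LinearMap.id : A' →ₗ[R] A'))
      (e.symm.surjective.comp (Prod.map_surjective.2 ⟨F'.aug_surjective, Function.surjective_id⟩))
    simp only [Module.finrank_prod, Module.finrank_fin_fun] at this
    omega
  have hker : ∀ {M : Type u} [AddCommGroup M] [Module R M] (F : FreeResolution R M)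
      (A : Type u) [AddCommGroup A] [Module R A],
      Nonempty (LinearMap.range (F.d 0) ≃ₗ[R]
        LinearMap.ker (F.aug.prodMap (LinearMap.id : A →ₗ[R] A))) := by
    intro M _ _ F A _ _
    refine ⟨LinearEquiv.ofBijective (LinearMap.codRestrict _
      (LinearMap.inl R _ A ∘ₗ (LinearMap.range (F.d 0)).subtype) ?_) ⟨?_, ?_⟩⟩
    · rintro ⟨_, v, rfl⟩
      simpa using F.exact_aug.apply_apply_eq_zero v
    · intro x y hxy
      exact Subtype.ext (congrArg Prod.fst (congrArg Subtype.val hxy))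
    · rintro ⟨⟨v, w⟩, hv⟩
      obtain ⟨hv, hw⟩ : F.aug v = 0 ∧ w = 0 := by simpa using hv
      exact ⟨⟨v, (F.exact_aug v).1 hv⟩, Subtype.ext (Prod.ext rfl hw.symm)⟩
  induction i with
  | zero =>
    intro M M' _ _ _ _ F F' hF hF' A A' _ _ _ _ _ _ _ _ hA e
    exact le_antisymm (h0 hF hF' hA e) (h0 hF' hF hA.symm e.symm)
  | succ i ih =>
    intro M M' _ _ _ _ F F' hF hF' A A' _ _ _ _ _ _ _ _ hA e
    have hr := le_antisymm (h0 hF hF' hA e) (h0 hF' hF hA.symm e.symm)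
    obtain ⟨s⟩ := nonempty_schanuel_equiv
      (p := e.toLinearMap ∘ₗ F.aug.prodMap (LinearMap.id : A →ₗ[R] A))
      (q := F'.aug.prodMap (LinearMap.id : A' →ₗ[R] A'))
      (e.surjective.comp (Prod.map_surjective.2 ⟨F.aug_surjective, Function.surjective_id⟩))
      (Prod.map_surjective.2 ⟨F'.aug_surjective, Function.surjective_id⟩)
    rw [LinearEquiv.ker_comp] at s
    obtain ⟨t⟩ := hker F A
    obtain ⟨t'⟩ := hker F' A'
    refine ih hF.shift hF'.shift (A := (Fin (F'.rank 0) → R) × A')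
      (A' := (Fin (F.rank 0) → R) × A) ?_
      ((t.prodCongr (LinearEquiv.refl R _)).trans
        (s.trans (t'.symm.prodCongr (LinearEquiv.refl R _))))
    simp only [Module.finrank_prod, Module.finrank_fin_fun]
    omega

/-- Two minimal free resolutions of the same module have the same ranks. -/
theorem rank_eq {I : Ideal R} (hI : I.IsMaximal) {F F' : FreeResolution R M}
    (hF : F.IsMinimal I) (hF' : F'.IsMinimal I) (i : ℕ) : F.rank i = F'.rank i :=
  rank_eq_of_stable_equiv hI i hF hF' (A := R) (A' := R) rfl (LinearEquiv.refl R _)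

end FreeResolution

end Uniqueness

/-! ### Projective dimension -/

section ProjectiveDimension

namespace FreeResolution

variable {R : Type u} [CommRing R] {M : Type u} [AddCommGroup M] [Module R M]

lemma shortExact_syzygy (F : FreeResolution R M) :
    (ShortComplex.mk (ModuleCat.ofHom (LinearMap.range (F.d 0)).subtype) (ModuleCat.ofHom F.aug)
      (by
        ext ⟨_, v, rfl⟩
        exact F.exact_aug.apply_apply_eq_zero v)).ShortExact where
  exact := by
    rw [ShortComplex.moduleCat_exact_iff]
    intro x hx
    exact ⟨⟨x, (F.exact_aug x).1 hx⟩, rfl⟩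
  mono_f := (ModuleCat.mono_iff_injective _).2 Subtype.val_injective
  epi_g := (ModuleCat.epi_iff_surjective _).2 F.aug_surjective

/-- A module with a free resolution of length less than `c` has projective dimension less
than `c`. -/
lemma hasProjectiveDimensionLT (c : ℕ) : ∀ {M : Type u} [AddCommGroup M] [Module R M]
    (F : FreeResolution R M), (∀ i, c ≤ i → F.rank i = 0) →
      HasProjectiveDimensionLT (ModuleCat.of R M) c := by
  induction c with
  | zero =>
    intro M _ _ F h
    have := F.subsingleton_of_rank_eq_zero (h 0 le_rfl)
    exact (ModuleCat.isZero_of_subsingleton (ModuleCat.of R M)).hasProjectiveDimensionLT_zero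
  | succ c ih =>
    intro M _ _ F h
    have h1 := ih F.shift fun i hi => h (i + 1) (Nat.succ_le_succ hi)
    have : Projective (ModuleCat.of R (Fin (F.rank 0) → R)) :=
      (IsProjective.iff_projective _).1 inferInstance
    exact F.shortExact_syzygy.hasProjectiveDimensionLT_X₃ c h1 (inferInstanceAs
      (HasProjectiveDimensionLT (ModuleCat.of R (Fin (F.rank 0) → R)) (c + 1)))

/-- A minimal free resolution of a projective module is concentrated in degree zero: the
kernel `K` of `F_0 → M` is a direct summand contained in `I F_0`, so `K = I K`, and `K = 0` by
Nakayama's lemma. -/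
lemma IsMinimal.rank_one_eq_zero [IsDomain R] [IsNoetherianRing R] {F : FreeResolution R M}
    {I : Ideal R} (hF : F.IsMinimal I) (hI : I ≠ ⊤) [Module.Projective R M] : F.rank 1 = 0 := by
  refine hF.rank_succ_eq_zero_of_d_eq_zero hI (LinearMap.range_eq_bot.1 ?_)
  obtain ⟨s, hs⟩ := Module.projective_lifting_property F.aug LinearMap.id F.aug_surjective
  have hs' : ∀ m, F.aug (s m) = m := fun m => LinearMap.congr_fun hs m
  have hle : LinearMap.range (F.d 0) ≤ I • LinearMap.range (F.d 0) := by
    rintro _ ⟨v, rfl⟩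
    have h1 : F.d 0 v = (LinearMap.id - s ∘ₗ F.aug : (Fin (F.rank 0) → R) →ₗ[R] _) (F.d 0 v) := by
      simp [F.exact_aug.apply_apply_eq_zero v]
    rw [h1, LinearMap.apply_eq_sum_single]
    refine sum_mem fun j _ => Submodule.smul_mem_smul (hF.d_apply_mem 0 v j) ?_
    refine (F.exact_aug _).1 ?_
    simp [hs']
  obtain ⟨r, hr, hr0⟩ := Submodule.exists_sub_one_mem_and_smul_eq_zero_of_fg_of_le_smul I _
    (IsNoetherian.noetherian (LinearMap.range (F.d 0))) hle
  have hne : r ≠ 0 := by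
    rintro rfl
    exact hI ((Ideal.eq_top_iff_one I).2 (by simpa using hr))
  rw [eq_bot_iff]
  intro v hv
  exact (smul_eq_zero.1 (hr0 v hv)).resolve_left hne

/-- A minimal free resolution is no longer than the projective dimension. -/
theorem IsMinimal.rank_eq_zero_of_hasProjectiveDimensionLT [IsDomain R] [IsNoetherianRing R]
    {I : Ideal R} (hI : I ≠ ⊤) (c : ℕ) : ∀ {M : Type u} [AddCommGroup M] [Module R M]
    {F : FreeResolution R M}, F.IsMinimal I → HasProjectiveDimensionLT (ModuleCat.of R M) c →
      F.rank c = 0 := by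
  induction c with
  | zero =>
    intro M _ _ F hF h
    have : Subsingleton M := ModuleCat.subsingleton_of_isZero
      (isZero_of_hasProjectiveDimensionLT_zero (ModuleCat.of R M))
    exact hF.rank_zero_eq_zero hI
  | succ c ih =>
    intro M _ _ F hF h
    rcases c with _ | c
    · have h1 : Projective (ModuleCat.of R M) := projective_iff_hasProjectiveDimensionLT_one.2 h
      have : Module.Projective R M := (IsProjective.iff_projective _).2 h1
      exact hF.rank_one_eq_zero hI
    · have : Projective (ModuleCat.of R (Fin (F.rank 0) → R)) :=
        (IsProjective.iff_projective _).1 inferInstance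
      exact ih hF.shift (F.shortExact_syzygy.hasProjectiveDimensionLT_X₁ (c + 1) (inferInstanceAs
        (HasProjectiveDimensionLT (ModuleCat.of R (Fin (F.rank 0) → R)) (c + 1))) h)

end FreeResolution

end ProjectiveDimension

/-! ### Change of rings for free resolutions -/

section MapEntries

variable {R S : Type*} [CommRing R] [CommRing S] {ι κ : Type*} [Fintype ι] [DecidableEq ι]


/-- The linear map between free modules over `S` obtained by applying the ring homomorphism `φ` to
the entries of the matrix of `g`. -/
noncomputable def LinearMap.mapEntries (φ : R →+* S) (g : (ι → R) →ₗ[R] (κ → R)) :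
    (ι → S) →ₗ[S] (κ → S) :=
  Matrix.toLin' ((LinearMap.toMatrix' g).map φ)


lemma LinearMap.mapEntries_single (φ : R →+* S) (g : (ι → R) →ₗ[R] (κ → R)) (j : ι) (l : κ) :
    g.mapEntries φ (Pi.single j 1) l = φ (g (Pi.single j 1) l) := by
  rw [mapEntries, Matrix.toLin'_apply, Matrix.mulVec_single_one, Matrix.col_apply,
    Matrix.map_apply, LinearMap.toMatrix'_apply]

lemma LinearMap.mapEntries_comp_apply (φ : R →+* S) (g : (ι → R) →ₗ[R] (κ → R)) (v : ι → R) :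
    g.mapEntries φ (fun i => φ (v i)) = fun l => φ (g v l) := by
  ext l
  rw [(g.mapEntries φ).apply_eq_sum_single, g.apply_eq_sum_single v, Finset.sum_apply,
    Finset.sum_apply, map_sum]
  simp [LinearMap.mapEntries_single]

end MapEntries

namespace FreeResolution

variable {R S : Type u} [CommRing R] [CommRing S] {M : Type u} [AddCommGroup M] [Module R M]

/-- The matrices of a free resolution stay exact after applying `φ`. -/
def IsExactMap (F : FreeResolution R M) (φ : R →+* S) : Prop :=
  ∀ i, Function.Exact ((F.d (i + 1)).mapEntries φ) ((F.d i).mapEntries φ)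

/-- The module over `S` presented by the image under `φ` of the presentation matrix of `M`. -/
abbrev Coker (F : FreeResolution R M) (φ : R →+* S) : Type u :=
  (Fin (F.rank 0) → S) ⧸ LinearMap.range ((F.d 0).mapEntries φ)

/-- The resolution obtained by applying `φ` to all matrices of `F`. -/
noncomputable def map (F : FreeResolution R M) (φ : R →+* S) (h : F.IsExactMap φ) :
    FreeResolution S (F.Coker φ) where
  rank := F.rank
  d i := (F.d i).mapEntries φ
  aug := Submodule.mkQ _
  aug_surjective := Submodule.mkQ_surjective _
  exact_aug := LinearMap.exact_iff.2 (Submodule.ker_mkQ _)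
  exact_d := h

lemma IsMinimal.map {F : FreeResolution R M} {I : Ideal R} (hF : F.IsMinimal I) {φ : R →+* S}
    (h : F.IsExactMap φ) {J : Ideal S} (hIJ : I ≤ J.comap φ) : (F.map φ h).IsMinimal J := by
  intro i j l
  have e : (F.map φ h).d i (Pi.single j 1) l = φ (F.d i (Pi.single j 1) l) :=
    LinearMap.mapEntries_single φ (F.d i) j l
  rw [e]
  exact hIJ (hF i j l)

lemma map_annihilator_le (F : FreeResolution R M) (φ : R →+* S) :
    (Module.annihilator R M).map φ ≤ Module.annihilator S (F.Coker φ) := by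
  rw [Ideal.map_le_iff_le_comap]
  intro a ha
  rw [Ideal.mem_comap, Module.mem_annihilator]
  intro m
  obtain ⟨v, rfl⟩ := Submodule.mkQ_surjective _ m
  rw [LinearMap.apply_eq_sum_single, Finset.smul_sum]
  refine Finset.sum_eq_zero fun j _ => ?_
  rw [smul_comm, ← map_smul]
  obtain ⟨w, hw⟩ := (F.exact_aug (a • Pi.single j 1)).1 (by
    rw [map_smul, Module.mem_annihilator.1 ha])
  have h1 : φ a • (Pi.single j 1 : Fin (F.rank 0) → S) =
      (F.d 0).mapEntries φ (fun i => φ (w i)) := by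
    rw [LinearMap.mapEntries_comp_apply, hw]
    ext l
    rcases eq_or_ne l j with rfl | hl
    · simp
    · simp [hl]
  rw [h1, Submodule.mkQ_apply, (Submodule.Quotient.mk_eq_zero _).2 (LinearMap.mem_range_self _ _),
    smul_zero]

section Surjective

variable [IsDomain R] {φ : R →+* S} {l : R}

/-- Cutting down by an element `l` that is a nonzerodivisor on the module keeps a free resolution
exact: `l` is then a nonzerodivisor on the cokernels of all differentials, so a cycle modulo `l` can
be corrected to a cycle by a multiple of `l`. -/
lemma isExactMap_of_surjective (F : FreeResolution R M) (hφ : Function.Surjective φ)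
    (hker : RingHom.ker φ = Ideal.span {l}) (hl : l ≠ 0) (hreg : ∀ m : M, l • m = 0 → m = 0) :
    F.IsExactMap φ := by
  have key : ∀ i y, l • y ∈ LinearMap.range (F.d i) → y ∈ LinearMap.range (F.d i) := by
    rintro (_ | i) y hy
    · refine (F.exact_aug y).1 (hreg _ ?_)
      rw [← map_smul]
      exact (F.exact_aug _).2 hy
    · refine (F.exact_d i y).1 ?_
      have := (F.exact_d i _).2 hy
      rw [map_smul] at this
      exact (smul_eq_zero.1 this).resolve_left hl
  have hlift : ∀ {m : ℕ} (v : Fin m → S), ∃ w : Fin m → R, (fun i => φ (w i)) = v := fun v =>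
    ⟨fun i => (hφ (v i)).choose, funext fun i => (hφ (v i)).choose_spec⟩
  have hdvd : ∀ {m : ℕ} (w : Fin m → R), (fun i => φ (w i)) = 0 → ∃ y, w = l • y := by
    intro m w hw
    have : ∀ i, ∃ y, w i = l * y := fun i => by
      have h : w i ∈ RingHom.ker φ := congrFun hw i
      rw [hker, Ideal.mem_span_singleton] at h
      exact h
    choose y hy using this
    exact ⟨y, funext hy⟩
  intro i v
  constructor
  · intro hv
    obtain ⟨w, rfl⟩ := hlift v
    rw [LinearMap.mapEntries_comp_apply] at hv
    obtain ⟨y, hy⟩ := hdvd _ hv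
    obtain ⟨z, hz⟩ := key i y (hy ▸ LinearMap.mem_range_self _ _)
    obtain ⟨x, hx⟩ := (F.exact_d i (w - l • z)).1 (by rw [map_sub, map_smul, hz, hy, sub_self])
    refine ⟨fun i => φ (x i), ?_⟩
    rw [LinearMap.mapEntries_comp_apply, hx]
    have hl0 : φ l = 0 := by
      rw [← RingHom.mem_ker, hker]
      exact Ideal.mem_span_singleton_self l
    ext j
    simp [hl0]
  · rintro ⟨v, rfl⟩
    obtain ⟨w, rfl⟩ := hlift v
    rw [LinearMap.mapEntries_comp_apply, LinearMap.mapEntries_comp_apply,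
      (F.exact_d i).apply_apply_eq_zero]
    ext j
    simp

end Surjective

/-- A flat extension of the base ring keeps a free resolution exact. -/
lemma isExactMap_of_flat [Algebra R S] [Module.Flat R S] (F : FreeResolution R M) :
    F.IsExactMap (algebraMap R S) := by
  have hcomm : ∀ {m m' : ℕ} (g : (Fin m → R) →ₗ[R] (Fin m' → R))
      (t : TensorProduct R S (Fin m → R)),
      g.mapEntries (algebraMap R S) (TensorProduct.piScalarRight R S S (Fin m) t) =
        TensorProduct.piScalarRight R S S (Fin m') (g.lTensor S t) := by
    intro m m' g t
    induction t with
    | zero => simp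
    | add x y hx hy => simp only [map_add, hx, hy]
    | tmul s v =>
      have h1 : ∀ {p : ℕ} (w : Fin p → R), TensorProduct.piScalarRight R S S (Fin p) (s ⊗ₜ[R] w) =
          s • fun i => algebraMap R S (w i) := by
        intro p w
        ext i
        simp [Algebra.smul_def, mul_comm]
      rw [LinearMap.lTensor_tmul, h1, h1, map_smul, LinearMap.mapEntries_comp_apply]
  intro i v
  obtain ⟨t, rfl⟩ := (TensorProduct.piScalarRight R S S (Fin (F.rank (i + 1)))).surjective v
  rw [hcomm, LinearEquiv.map_eq_zero_iff, Module.Flat.lTensor_exact S (F.exact_d i) t]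
  constructor
  · rintro ⟨u, rfl⟩
    exact ⟨_, hcomm _ u⟩
  · rintro ⟨w, hw⟩
    obtain ⟨u, rfl⟩ := (TensorProduct.piScalarRight R S S (Fin (F.rank (i + 2)))).surjective w
    rw [hcomm] at hw
    exact ⟨u, (LinearEquiv.injective _) hw⟩

end FreeResolution

section Graded

variable {k : Type u} [Field k] {n : ℕ} {N : Type u} [AddCommGroup N]
  [Module (MvPolynomial (Fin n) k) N] {𝓜 : ℤ → AddSubgroup N}

/-- The resolution underlying a minimal graded free resolution. -/
def MinimalGradedFreeResolution.toFreeResolution (F : MinimalGradedFreeResolution k n 𝓜) :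
    FreeResolution (MvPolynomial (Fin n) k) N :=
  { F with }

lemma MinimalGradedFreeResolution.isMinimal (F : MinimalGradedFreeResolution k n 𝓜) :
    F.toFreeResolution.IsMinimal (idealOfVars (Fin n) k) :=
  F.minimal

lemma isMaximal_idealOfVars {σ : Type*} : (idealOfVars σ k).IsMaximal := by
  have : idealOfVars σ k = RingHom.ker (constantCoeff (R := k) (σ := σ)) := by
    ext p
    exact mem_span_range_X_iff
  rw [this]
  exact RingHom.ker_isMaximal_of_surjective _ fun a => ⟨C a, constantCoeff_C _ a⟩

lemma idealOfVars_le_comap {k' : Type*} [Field k'] {σ τ : Type*}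
    {φ : MvPolynomial σ k →+* MvPolynomial τ k'}
    (hφ : ∀ p e, p.IsHomogeneous e → (φ p).IsHomogeneous e) :
    idealOfVars σ k ≤ (idealOfVars τ k').comap φ := by
  rw [idealOfVars, Ideal.span_le]
  rintro _ ⟨i, rfl⟩
  have h1 := hφ _ _ (isHomogeneous_X k i)
  refine mem_span_range_X_iff.2 ?_
  rw [constantCoeff_eq]
  exact h1.coeff_eq_zero (by simp)

/-- The ranks in a minimal graded free resolution are the Betti numbers. -/
theorem MinimalGradedFreeResolution.hasBettiNumbers (F : MinimalGradedFreeResolution k n 𝓜) :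
    HasBettiNumbers k n 𝓜 F.rank :=
  ⟨⟨F⟩, fun F' i => FreeResolution.rank_eq isMaximal_idealOfVars F'.isMinimal F.isMinimal i⟩

/-- The matrices of the resolution preserve degrees, when the basis vectors are given the
degrees `deg`. -/
def FreeResolution.IsHomogeneous (F : FreeResolution (MvPolynomial (Fin n) k) N)
    (deg : (i : ℕ) → Fin (F.rank i) → ℤ) : Prop :=
  ∀ i j l, F.d i (Pi.single j 1) l = 0 ∨
    ∃ e : ℕ, (F.d i (Pi.single j 1) l).IsHomogeneous e ∧ (e : ℤ) + deg i l = deg (i + 1) j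

/-- The module presented by homogeneous matrices is graded, and the matrices give its minimal graded
free resolution. -/
theorem FreeResolution.exists_graded_map {k' : Type u} [Field k'] {n' : ℕ}
    {F : FreeResolution (MvPolynomial (Fin n) k) N}
    (hF : F.IsMinimal (idealOfVars (Fin n) k)) {deg : (i : ℕ) → Fin (F.rank i) → ℤ}
    (hdeg : F.IsHomogeneous deg)
    (φ : MvPolynomial (Fin n) k →+* MvPolynomial (Fin n') k')
    (hφ : ∀ p e, p.IsHomogeneous e → (φ p).IsHomogeneous e) (h : F.IsExactMap φ) :
    ∃ 𝓝 : ℤ → AddSubgroup (F.Coker φ), IsGradedPolyModule k' n' 𝓝 ∧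
      (F.map φ h).IsMinimal (idealOfVars (Fin n') k') ∧ (F.map φ h).IsHomogeneous deg ∧
      HasBettiNumbers k' n' 𝓝 F.rank := by
  have hmin : (F.map φ h).IsMinimal (idealOfVars (Fin n') k') :=
    hF.map h (idealOfVars_le_comap hφ)
  have hhom : (F.map φ h).IsHomogeneous deg := by
    intro i j l
    have e : (F.map φ h).d i (Pi.single j 1) l = φ (F.d i (Pi.single j 1) l) :=
      LinearMap.mapEntries_single φ (F.d i) j l
    rw [e]
    rcases hdeg i j l with h0 | ⟨e, he, hd⟩
    · left; rw [h0, map_zero]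
    · exact Or.inr ⟨e, hφ _ _ he, hd⟩
  have hproj : ∀ j, (freeProjections (deg 0)).proj (deg 1 j)
      ((F.d 0).mapEntries φ (Pi.single j 1)) = (F.d 0).mapEntries φ (Pi.single j 1) := by
    intro j
    ext1 l
    rw [freeProjections_apply, intComponent_eq_self_iff]
    rcases hhom 0 j l with h0 | ⟨e, he, hd⟩
    · exact Or.inl h0
    · exact Or.inr ⟨e, he, eq_sub_iff_add_eq.2 hd⟩
  have hsingle : ∀ j : Fin (F.rank 0), (freeProjections (deg 0)).proj (deg 0 j) (Pi.single j 1) =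
      (Pi.single j 1 : Fin (F.rank 0) → MvPolynomial (Fin n') k') := by
    intro j
    ext1 l
    rw [freeProjections_apply]
    rcases eq_or_ne l j with rfl | hl
    · rw [Pi.single_eq_same, sub_self, intComponent_zero_eq_C, map_one, C_1]
    · rw [Pi.single_eq_of_ne hl, map_zero]
  let G := (freeProjections (deg 0)).quotient (LinearMap.range ((F.d 0).mapEntries φ)) (by
    rintro D _ ⟨v, rfl⟩
    exact ⟨_, ((freeProjections (deg 0)).proj_map_free hproj D v).symm⟩)
  refine ⟨_, G.isGradedPolyModule, hmin, hhom, ?_⟩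
  let F' : MinimalGradedFreeResolution k' n' fun j => (G.proj j).range :=
    { F.map φ h with
      deg := deg
      aug_mem := fun j => by
        refine ⟨Submodule.mkQ _ (Pi.single j 1), ?_⟩
        exact congrArg (Submodule.mkQ _) (hsingle j)
      d_homogeneous := hhom
      minimal := hmin }
  exact F'.hasBettiNumbers

end Graded

/-! ### Cutting by linear forms and its consequences -/

section Elimination

variable {k : Type u} [Field k]

/-- Solving the linear equation `∑ a_j x_j = 0` for a variable identifies the quotient by a nonzero
linear form with a polynomial ring in one variable less. -/
lemma exists_elimination {n : ℕ} {a : Fin (n + 1) → k} (ha : a ≠ 0) :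
    ∃ φ : MvPolynomial (Fin (n + 1)) k →+* MvPolynomial (Fin n) k,
      RingHom.ker φ = Ideal.span {∑ j, C (a j) * X j} ∧
      (∀ p e, p.IsHomogeneous e → (φ p).IsHomogeneous e) ∧
      ∃ s : Fin n → Fin (n + 1), ∀ p, φ (rename s p) = p := by
  obtain ⟨i, hi⟩ := Function.ne_iff.1 ha
  rw [Pi.zero_apply] at hi
  let g : Fin (n + 1) → MvPolynomial (Fin n) k :=
    i.insertNth (-(C (a i)⁻¹ * ∑ j, C (a (i.succAbove j)) * X j)) X
  let φ : MvPolynomial (Fin (n + 1)) k →ₐ[k] MvPolynomial (Fin n) k := aeval g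
  have hgi : g i = -(C (a i)⁻¹ * ∑ j, C (a (i.succAbove j)) * X j) := Fin.insertNth_apply_same ..
  have hgs : ∀ j, g (i.succAbove j) = X j := fun j => Fin.insertNth_apply_succAbove ..
  have hsec : ∀ p, φ (rename i.succAbove p) = p := by
    intro p
    have : φ.comp (rename i.succAbove) = AlgHom.id k _ := by
      ext j : 1
      simp [φ, hgs]
    exact DFunLike.congr_fun this p
  have hl : (∑ j, C (a j) * X j : MvPolynomial (Fin (n + 1)) k) =
      C (a i) * X i + ∑ j, C (a (i.succAbove j)) * X (i.succAbove j) :=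
    Fin.sum_univ_succAbove _ i
  have hinv : (C (a i)⁻¹ * C (a i) : MvPolynomial (Fin (n + 1)) k) = 1 := by
    rw [← C_mul, inv_mul_cancel₀ hi, C_1]
  have hinv' : (C (a i) * C (a i)⁻¹ : MvPolynomial (Fin n) k) = 1 := by
    rw [← C_mul, mul_inv_cancel₀ hi, C_1]
  have hhom : ∀ j, (g j).IsHomogeneous 1 := by
    intro j
    rcases Fin.eq_self_or_eq_succAbove i j with rfl | ⟨j, rfl⟩
    · rw [hgi, ← neg_one_mul, ← C_1, ← C_neg, ← mul_assoc, ← C_mul]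
      refine IsHomogeneous.C_mul (IsHomogeneous.sum _ _ _ fun m _ => ?_) _
      exact (isHomogeneous_X k m).C_mul _
    · rw [hgs]; exact isHomogeneous_X k j
  refine ⟨φ.toRingHom, le_antisymm ?_ ?_, fun p e hp => ?_, i.succAbove, hsec⟩
  · -- modulo the linear form, `φ` followed by its section is the identity
    let l : MvPolynomial (Fin (n + 1)) k := ∑ j, C (a j) * X j
    have hmk : (Ideal.Quotient.mkₐ k (Ideal.span {l})).comp ((rename i.succAbove).comp φ) =
        Ideal.Quotient.mkₐ k (Ideal.span {l}) := by
      ext j : 1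
      rw [AlgHom.comp_apply, AlgHom.comp_apply, Ideal.Quotient.mkₐ_eq_mk, Ideal.Quotient.eq]
      rcases Fin.eq_self_or_eq_succAbove i j with rfl | ⟨j, rfl⟩
      · refine Ideal.mem_span_singleton.2 ⟨-C (a j)⁻¹, ?_⟩
        simp only [φ, aeval_X, hgi, map_neg, map_mul, map_sum, rename_X, rename_C, l, hl]
        linear_combination (X j : MvPolynomial (Fin (n + 1)) k) * hinv
      · simp [φ, hgs]
    intro p hp
    have h1 := DFunLike.congr_fun hmk p
    have hp' : φ p = 0 := hp
    rw [AlgHom.comp_apply, AlgHom.comp_apply, hp', map_zero, map_zero] at h1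
    exact Ideal.Quotient.eq_zero_iff_mem.1 h1.symm
  · rw [Ideal.span_singleton_le_iff_mem, RingHom.mem_ker]
    change φ _ = 0
    rw [hl]
    simp only [φ, map_add, map_mul, map_sum, aeval_X, hgi, hgs, algHom_C, algebraMap_eq]
    linear_combination -(∑ j, C (a (i.succAbove j)) * X j : MvPolynomial (Fin n) k) * hinv'
  · have := hp.aeval g hhom
    rwa [one_mul] at this

lemma sum_C_mul_X_mem_idealOfVars {n : ℕ} (a : Fin n → k) :
    (∑ j, C (a j) * X j : MvPolynomial (Fin n) k) ∈ idealOfVars (Fin n) k :=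
  sum_mem fun j _ => Ideal.mul_mem_left _ _ (Ideal.subset_span ⟨j, rfl⟩)

lemma sum_C_mul_X_ne_zero {n : ℕ} {a : Fin n → k} (ha : a ≠ 0) :
    (∑ j, C (a j) * X j : MvPolynomial (Fin n) k) ≠ 0 := by
  obtain ⟨i, hi⟩ := Function.ne_iff.1 ha
  intro h
  have := congrArg (coeff (Finsupp.single i 1)) h
  rw [coeff_sum, Finset.sum_eq_single i] at this
  · exact hi (by simpa using this)
  · intro j _ hj
    simp [coeff_C_mul, coeff_X, Finsupp.single_left_inj, hj]
  · simp

end Elimination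

namespace FreeResolution

variable {R S : Type u} [CommRing R] [CommRing S] {M : Type u} [AddCommGroup M] [Module R M]

/-- When `φ` is surjective with kernel generated by `l`, the module presented over `S` receives a
`φ`-semilinear map from `M` whose kernel lies in `l M`. -/
lemma exists_semilinear_map (F : FreeResolution R M) {φ : R →+* S} {l : R}
    (hφ : Function.Surjective φ) (hker : RingHom.ker φ = Ideal.span {l}) :
    ∃ π : M →ₛₗ[φ] F.Coker φ, ∀ m, π m = 0 → ∃ m', m = l • m' := by
  let q : (Fin (F.rank 0) → R) →ₛₗ[φ] F.Coker φ :=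
    { toFun := fun w => Submodule.mkQ (LinearMap.range ((F.d 0).mapEntries φ)) fun i => φ (w i)
      map_add' := fun v w => by
        rw [← map_add]
        congr 1
        ext i
        simp
      map_smul' := fun r w => by
        rw [← map_smul]
        congr 1
        ext i
        simp }
  have hq : LinearMap.ker F.aug ≤ LinearMap.ker q := by
    intro w hw
    obtain ⟨v, rfl⟩ := (F.exact_aug w).1 hw
    refine (Submodule.Quotient.mk_eq_zero _).2 ⟨fun i => φ (v i), ?_⟩
    exact LinearMap.mapEntries_comp_apply φ (F.d 0) v
  let e := F.aug.quotKerEquivOfSurjective F.aug_surjective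
  have he : ∀ w, e.symm (F.aug w) = Submodule.Quotient.mk w := fun w => by
    rw [LinearEquiv.symm_apply_eq]; rfl
  refine ⟨((LinearMap.ker F.aug).liftQ q hq).comp e.symm.toLinearMap, fun m hm => ?_⟩
  obtain ⟨w, rfl⟩ := F.aug_surjective m
  have hm' : q w = 0 := by
    have : (((LinearMap.ker F.aug).liftQ q hq).comp e.symm.toLinearMap) (F.aug w) = q w := by
      change (LinearMap.ker F.aug).liftQ q hq (e.symm (F.aug w)) = q w
      rw [he]
      rfl
    rw [← this, hm]
  obtain ⟨v, hv⟩ := (Submodule.Quotient.mk_eq_zero _).1 hm'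
  choose u hu using fun i => hφ (v i)
  obtain rfl : (fun i => φ (u i)) = v := funext hu
  rw [LinearMap.mapEntries_comp_apply] at hv
  have hdiff : ∀ i, ∃ y, w i - F.d 0 u i = l * y := by
    intro i
    have h : w i - F.d 0 u i ∈ RingHom.ker φ := by
      rw [RingHom.mem_ker, map_sub, sub_eq_zero]
      exact (congrFun hv i).symm
    rw [hker, Ideal.mem_span_singleton] at h
    exact h
  choose y hy using hdiff
  refine ⟨F.aug y, ?_⟩
  rw [← map_smul, ← sub_eq_zero, ← map_sub]
  refine (F.exact_aug _).2 ⟨u, ?_⟩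
  ext i
  simp only [Pi.sub_apply, Pi.smul_apply, smul_eq_mul]
  linear_combination -hy i

end FreeResolution

section Polynomial

variable {k : Type u} [Field k]

/-- **Hilbert's syzygy theorem** for minimal resolutions: dividing the resolution of the first
syzygy module, which is torsion-free, by a variable gives a minimal resolution over a polynomial
ring in one variable less. -/
theorem FreeResolution.IsMinimal.rank_succ_eq_zero (n : ℕ) :
    ∀ {M : Type u} [AddCommGroup M] [Module (MvPolynomial (Fin n) k) M]
      {F : FreeResolution (MvPolynomial (Fin n) k) M}, F.IsMinimal (idealOfVars (Fin n) k) →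
      F.rank (n + 1) = 0 := by
  induction n with
  | zero =>
    intro M _ _ F hF
    refine hF.rank_succ_eq_zero_of_d_eq_zero isMaximal_idealOfVars.ne_top ?_
    ext j l
    have := hF 0 j l
    rw [idealOfVars, Set.range_eq_empty, Ideal.span_empty, Ideal.mem_bot] at this
    simp [this]
  | succ n ih =>
    intro M _ _ F hF
    have ha : (fun _ => 1 : Fin (n + 1) → k) ≠ 0 := fun h => one_ne_zero (congrFun h 0)
    obtain ⟨φ, hker, hhom, s, hs⟩ := exists_elimination ha
    have hex := F.shift.isExactMap_of_surjective (fun p => ⟨_, hs p⟩) hker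
      (sum_C_mul_X_ne_zero ha) fun m hm => (smul_eq_zero.1 hm).resolve_left (sum_C_mul_X_ne_zero ha)
    exact ih (hF.shift.map hex (idealOfVars_le_comap hhom))

/-- A module over `k[x_0, …, x_{n-1}]` with a free resolution of length less than `n` has no nonzero
element killed by all the variables. Such an element lifts to `f ∈ F_0`, and for a linear form `l`
the class of `l f` in `Z / l Z`, where `Z` is the first syzygy module, is again killed by the
variables. -/
theorem FreeResolution.eq_zero_of_forall_X_smul_eq_zero (n : ℕ) :
    ∀ {M : Type u} [AddCommGroup M] [Module (MvPolynomial (Fin n) k) M]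
      (F : FreeResolution (MvPolynomial (Fin n) k) M), F.rank n = 0 →
      ∀ m : M, (∀ i : Fin n, (X i : MvPolynomial (Fin n) k) • m = 0) → m = 0 := by
  induction n with
  | zero =>
    intro M _ _ F hF m _
    have := F.subsingleton_of_rank_eq_zero hF
    exact Subsingleton.elim _ _
  | succ n ih =>
    intro M _ _ F hF m hm
    have ha : (fun _ => 1 : Fin (n + 1) → k) ≠ 0 := fun h => one_ne_zero (congrFun h 0)
    obtain ⟨φ, hker, hhom, s, hs⟩ := exists_elimination ha
    have hl := sum_C_mul_X_ne_zero ha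
    have hlm := sum_C_mul_X_mem_idealOfVars (fun _ => 1 : Fin (n + 1) → k)
    generalize (∑ j, C ((fun _ => 1 : Fin (n + 1) → k) j) * X j) = l at hker hl hlm
    have hφ : Function.Surjective φ := fun p => ⟨_, hs p⟩
    have hex := F.shift.isExactMap_of_surjective hφ hker hl
      fun m hm => (smul_eq_zero.1 hm).resolve_left hl
    have hvars : ∀ p ∈ idealOfVars (Fin (n + 1)) k, p • m = 0 := by
      intro p hp
      have : idealOfVars (Fin (n + 1)) k ≤ LinearMap.ker (LinearMap.toSpanSingleton _ M m) := by
        rw [idealOfVars, Ideal.span_le]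
        rintro _ ⟨i, rfl⟩
        exact hm i
      exact this hp
    obtain ⟨f, rfl⟩ := F.aug_surjective m
    have hrange : ∀ p ∈ idealOfVars (Fin (n + 1)) k, p • f ∈ LinearMap.range (F.d 0) := by
      intro p hp
      refine (F.exact_aug _).1 ?_
      rw [map_smul, hvars p hp]
    obtain ⟨π, hπ⟩ := F.shift.exists_semilinear_map hφ hker
    have h0 : π ⟨l • f, hrange l hlm⟩ = 0 := by
      refine ih (F.shift.map φ hex) hF _ fun i => ?_
      have h1 : φ (X (s i)) = X i := by rw [← hs (X i), rename_X]
      rw [← h1, ← π.map_smulₛₗ]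
      have h2 : (X (s i) : MvPolynomial (Fin (n + 1)) k) •
          (⟨l • f, hrange l hlm⟩ : LinearMap.range (F.d 0)) =
            l • ⟨X (s i) • f, hrange _ (Ideal.subset_span ⟨s i, rfl⟩)⟩ :=
        Subtype.ext (smul_comm _ _ _)
      have hφl : φ l = 0 := by
        rw [← RingHom.mem_ker, hker]
        exact Ideal.mem_span_singleton_self l
      rw [h2, π.map_smulₛₗ, hφl, zero_smul]
    obtain ⟨⟨z, hz⟩, hzl⟩ := hπ _ h0
    have hfz : f = z := smul_right_injective _ hl (congrArg Subtype.val hzl)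
    rw [hfz]
    exact (F.exact_aug z).2 hz

end Polynomial

/-! ### Dimension and Artinian reduction -/

section Dimension

lemma WithBot.le_of_add_one_le_natCast_add_one {x : WithBot ℕ∞} {d : ℕ}
    (h : x + 1 ≤ ((d + 1 : ℕ) : WithBot ℕ∞)) : x ≤ (d : WithBot ℕ∞) := by
  induction x with
  | bot => exact bot_le
  | coe x =>
    have h' : x + 1 ≤ ((d + 1 : ℕ) : ℕ∞) := by exact_mod_cast h
    have h2 : x ≤ (d : ℕ∞) := by
      rw [Nat.cast_add, Nat.cast_one] at h'
      exact (ENat.add_le_add_iff_right ENat.one_ne_top).1 h'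
    exact_mod_cast h2

lemma Ideal.le_height_of_forall_isPrime {R : Type*} [CommRing R] {I : Ideal R} {c : ℕ∞}
    (h : ∀ P : Ideal R, P.IsPrime → I ≤ P → c ≤ P.height) : c ≤ I.height := by
  rw [Ideal.height_eq_inf_minimalPrimes]
  exact le_iInf₂ fun P hP => h P hP.1.1 hP.1.2

lemma Order.height_head_add_length_le {α : Type*} [Preorder α] (p : LTSeries α) :
    Order.height p.head + p.length ≤ Order.height p.last := by
  have h : ∀ (i : ℕ) (hi : i < p.length + 1),
      Order.height p.head + i ≤ Order.height (p ⟨i, hi⟩) := by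
    intro i
    induction i with
    | zero => intro hi; simp [RelSeries.head]
    | succ i ih =>
      intro hi
      have h1 := ih (by omega)
      have h2 := Order.height_add_one_le
        (p.strictMono (show (⟨i, by omega⟩ : Fin (p.length + 1)) < ⟨i + 1, hi⟩ from
          Nat.lt_succ_self i))
      calc Order.height p.head + ((i + 1 : ℕ) : ℕ∞) = Order.height p.head + i + 1 := by
            push_cast; rw [add_assoc]
        _ ≤ Order.height (p ⟨i, by omega⟩) + 1 := by gcongr
        _ ≤ _ := h2
  exact h p.length (Nat.lt_succ_self _)

lemma ringKrullDim_quotient_le_of_le_height {R : Type*} [CommRing R] {I : Ideal R} {c n d : ℕ}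
    (hc : (c : ℕ∞) ≤ I.height) (hn : ringKrullDim R ≤ n) (hd : n ≤ c + d) :
    ringKrullDim (R ⧸ I) ≤ d := by
  rw [ringKrullDim_quotient]
  refine iSup_le fun p => ?_
  let q : LTSeries (PrimeSpectrum R) := p.map Subtype.val fun _ _ h => h
  have h1 := Order.height_head_add_length_le q
  have h2 : (c : ℕ∞) ≤ Order.height q.head := by
    rw [← PrimeSpectrum.height_eq_orderHeight]
    exact hc.trans (Ideal.height_mono p.head.2)
  have h3 : (Order.height q.last : WithBot ℕ∞) ≤ n := (Order.height_le_krullDim _).trans hn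
  have h4 : Order.height q.last ≤ (n : ℕ∞) := by exact_mod_cast h3
  have h5 : ((c + p.length : ℕ) : ℕ∞) ≤ (n : ℕ∞) := by
    push_cast
    exact (add_le_add h2 le_rfl).trans (h1.trans h4)
  have h6 : c + p.length ≤ n := by exact_mod_cast h5
  have h7 : p.length ≤ d := by omega
  exact_mod_cast h7

/-- Dividing by an element that is a nonzerodivisor on the module lowers the dimension. -/
lemma FreeResolution.ringKrullDim_map_le {R S : Type u} [CommRing R] [CommRing S] {M : Type u}
    [AddCommGroup M] [Module R M] (F : FreeResolution R M) {φ : R →+* S} {l : R}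
    (hφ : Function.Surjective φ) (hl : φ l = 0) (hreg : ∀ m : M, l • m = 0 → m = 0) :
    ringKrullDim (S ⧸ Module.annihilator S (F.Coker φ)) + 1 ≤
      ringKrullDim (R ⧸ Module.annihilator R M) := by
  have hnz : Ideal.Quotient.mk (Module.annihilator R M) l ∈
      nonZeroDivisors (R ⧸ Module.annihilator R M) := by
    rw [mem_nonZeroDivisors_iff_right]
    intro x hx
    obtain ⟨r, rfl⟩ := Ideal.Quotient.mk_surjective x
    rw [← map_mul, Ideal.Quotient.eq_zero_iff_mem, Module.mem_annihilator] at hx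
    rw [Ideal.Quotient.eq_zero_iff_mem, Module.mem_annihilator]
    intro m
    refine hreg _ ?_
    rw [smul_smul, mul_comm]
    exact hx m
  refine le_trans (add_le_add ?_ le_rfl) (ringKrullDim_quotient_succ_le_of_nonZeroDivisor hnz)
  let ψ : R ⧸ Module.annihilator R M →+* S ⧸ Module.annihilator S (F.Coker φ) :=
    Ideal.quotientMap _ φ (Ideal.map_le_iff_le_comap.1 (F.map_annihilator_le φ))
  have hψ : Function.Surjective ψ := Ideal.quotientMap_surjective hφ
  refine ringKrullDim_le_of_surjective (Ideal.Quotient.lift _ ψ ?_)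
    (Ideal.Quotient.lift_surjective_of_surjective _ _ hψ)
  intro a ha
  obtain ⟨b, rfl⟩ := Ideal.mem_span_singleton.1 ha
  rw [map_mul, Ideal.quotientMap_mk, hl, map_zero, zero_mul]

lemma isFiniteLength_of_ringKrullDim_le_zero {R : Type u} [CommRing R] [IsNoetherianRing R]
    {M : Type u} [AddCommGroup M] [Module R M] [Module.Finite R M]
    (h : ringKrullDim (R ⧸ Module.annihilator R M) ≤ 0) : IsFiniteLength R M := by
  rw [isFiniteLength_iff_isNoetherian_isArtinian]
  refine ⟨inferInstance, ?_⟩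
  have : Ring.KrullDimLE 0 (R ⧸ Module.annihilator R M) := Ring.krullDimLE_iff.2 h
  have : IsArtinianRing (R ⧸ Module.annihilator R M) := isArtinianRing_iff_krullDimLE_zero.2 this
  let := (Module.isTorsionBySet_annihilator R M).module
  have hst : IsScalarTower R (R ⧸ Module.annihilator R M) M :=
    (Module.isTorsionBySet_annihilator R M).isScalarTower
  have : Module.Finite (R ⧸ Module.annihilator R M) M :=
    Module.Finite.of_restrictScalars_finite R _ M
  have : IsArtinian (R ⧸ Module.annihilator R M) M := inferInstance
  exact isArtinian_of_surjective_algebraMap (S := R) (R := R ⧸ Module.annihilator R M)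
    Ideal.Quotient.mk_surjective

end Dimension

section PrimeAvoidance

variable {k : Type u} [Field k]

/-- Over an infinite field, a finitely generated module without nonzero elements killed by all
the variables has a linear form as a nonzerodivisor: the linear forms in an associated prime
are a proper subspace of all linear forms, and finitely many proper subspaces do not cover. -/
lemma exists_regular_linearForm [Infinite k] {n : ℕ} {M : Type u} [AddCommGroup M]
    [Module (MvPolynomial (Fin n) k) M] [Module.Finite (MvPolynomial (Fin n) k) M] [Nontrivial M]
    (hsoc : ∀ m : M, (∀ i : Fin n, (X i : MvPolynomial (Fin n) k) • m = 0) → m = 0) :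
    ∃ a : Fin n → k, a ≠ 0 ∧
      ∀ m : M, (∑ j, C (a j) * X j : MvPolynomial (Fin n) k) • m = 0 → m = 0 := by
  classical
  let L : (Fin n → k) →ₗ[k] MvPolynomial (Fin n) k := Fintype.linearCombination k X
  have hL : ∀ a, L a = ∑ j, C (a j) * X j := fun a => by
    simp only [L, Fintype.linearCombination_apply, smul_eq_C_mul]
  have hfin := associatedPrimes.finite (MvPolynomial (Fin n) k) M
  let V : Ideal (MvPolynomial (Fin n) k) → Submodule k (Fin n → k) :=
    fun P => (P.restrictScalars k).comap L
  have htop : ⊤ ∉ hfin.toFinset.image V := by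
    intro h
    obtain ⟨P, hP, hPV⟩ := Finset.mem_image.1 h
    rw [Set.Finite.mem_toFinset, AssociatedPrimes.mem_iff, isAssociatedPrime_iff] at hP
    obtain ⟨hprime, x, rfl⟩ := hP
    refine hprime.ne_top ((Ideal.eq_top_iff_one _).2 ?_)
    have hx : x = 0 := hsoc x fun i => by
      have h1 : (Pi.single i 1 : Fin n → k) ∈ V (Submodule.colon ⊥ {x}) := hPV ▸ Submodule.mem_top
      have h2 : L (Pi.single i 1) ∈ Submodule.colon (⊥ : Submodule (MvPolynomial (Fin n) k) M) {x} :=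
        h1
      rwa [Submodule.mem_colon_singleton, Submodule.mem_bot, Fintype.linearCombination_apply_single,
        one_smul] at h2
    rw [Submodule.mem_colon_singleton, hx, smul_zero]
    exact Submodule.zero_mem _
  obtain ⟨a, ha⟩ := (Set.ne_univ_iff_exists_notMem _).1
    (Subspace.biUnion_ne_univ_of_top_notMem htop)
  have ha' : ∀ P ∈ associatedPrimes (MvPolynomial (Fin n) k) M, L a ∉ P := by
    intro P hP hmem
    exact ha (Set.mem_biUnion (Finset.mem_image_of_mem V (hfin.mem_toFinset.2 hP)) hmem)
  refine ⟨a, ?_, ?_⟩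
  · rintro rfl
    obtain ⟨P, hP⟩ := associatedPrimes.nonempty (MvPolynomial (Fin n) k) M
    exact ha' P hP (by rw [map_zero]; exact P.zero_mem)
  · have hreg : IsSMulRegular M (L a) := by
      by_contra h
      have : L a ∈ ⋃ p ∈ associatedPrimes (MvPolynomial (Fin n) k) M,
          (p : Set (MvPolynomial (Fin n) k)) := by
        rw [biUnion_associatedPrimes_eq_compl_regular]
        exact h
      obtain ⟨P, hP, hmem⟩ := Set.mem_iUnion₂.1 this
      exact ha' P hP hmem
    intro m hm
    rw [← hL] at hm
    exact hreg (by simpa using hm)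

end PrimeAvoidance

section ArtinianReduction

variable {k : Type u} [Field k]

/-- A module with a free resolution is finitely generated. -/
lemma FreeResolution.finite {R : Type u} [CommRing R] {M : Type u} [AddCommGroup M] [Module R M]
    (F : FreeResolution R M) : Module.Finite R M :=
  Module.Finite.of_surjective F.aug F.aug_surjective

/-- Artinian reduction: over an infinite field, a graded module over `k[x_0, …, x_{c+d-1}]` of
dimension at most `d` with a minimal resolution of length at most `c` can be cut down by `d` linear
forms to a module of finite length with the same Betti numbers. -/
theorem FreeResolution.exists_finite_length [Infinite k] (c d : ℕ) :
    ∀ {M : Type u} [AddCommGroup M] [Module (MvPolynomial (Fin (c + d)) k) M]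
      {F : FreeResolution (MvPolynomial (Fin (c + d)) k) M},
      F.IsMinimal (idealOfVars (Fin (c + d)) k) → ∀ {deg : (i : ℕ) → Fin (F.rank i) → ℤ},
      F.IsHomogeneous deg → F.rank (c + 1) = 0 → F.rank 0 ≠ 0 →
      ringKrullDim (MvPolynomial (Fin (c + d)) k ⧸
        Module.annihilator (MvPolynomial (Fin (c + d)) k) M) ≤ d →
      ∃ (M' : Type u) (_ : AddCommGroup M') (_ : Module (MvPolynomial (Fin c) k) M')
        (𝓜' : ℤ → AddSubgroup M'), IsGradedPolyModule k c 𝓜' ∧ Nontrivial M' ∧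
          IsFiniteLength (MvPolynomial (Fin c) k) M' ∧ HasBettiNumbers k c 𝓜' F.rank := by
  induction d with
  | zero =>
    intro M _ _ F hF deg hdeg _ h0 hdim
    have hex : F.IsExactMap (RingHom.id _) := F.isExactMap_of_flat
    obtain ⟨𝓝, hgr, hmin, -, hbetti⟩ :=
      FreeResolution.exists_graded_map hF hdeg (RingHom.id _) (fun _ _ h => h) hex
    have := (F.map _ hex).finite
    refine ⟨_, _, _, 𝓝, hgr, ?_, isFiniteLength_of_ringKrullDim_le_zero ?_, hbetti⟩
    · by_contra h
      rw [not_nontrivial_iff_subsingleton] at h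
      exact h0 (hmin.rank_zero_eq_zero isMaximal_idealOfVars.ne_top)
    · have hle := F.map_annihilator_le (RingHom.id _)
      rw [Ideal.map_id] at hle
      exact (ringKrullDim_le_of_surjective (Ideal.Quotient.factor hle)
        (Ideal.Quotient.factor_surjective hle)).trans hdim
  | succ d ih =>
    intro M _ _ F hF deg hdeg hc h0 hdim
    have := F.finite
    have : Nontrivial M := by
      by_contra h
      rw [not_nontrivial_iff_subsingleton] at h
      exact h0 (hF.rank_zero_eq_zero isMaximal_idealOfVars.ne_top)
    obtain ⟨a, ha, hreg⟩ := exists_regular_linearForm (F.eq_zero_of_forall_X_smul_eq_zero _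
      (hF.rank_eq_zero_of_le isMaximal_idealOfVars.ne_top hc (by omega)))
    obtain ⟨φ, hker, hhom, s, hs⟩ := exists_elimination (n := c + d) ha
    have hφ : Function.Surjective φ := fun p => ⟨_, hs p⟩
    have hex := F.isExactMap_of_surjective hφ hker (sum_C_mul_X_ne_zero ha) hreg
    obtain ⟨-, -, hmin, hdeg', -⟩ := FreeResolution.exists_graded_map hF hdeg φ hhom hex
    refine ih hmin hdeg' hc h0 (WithBot.le_of_add_one_le_natCast_add_one
      ((F.ringKrullDim_map_le hφ ?_ hreg).trans hdim))
    rw [← RingHom.mem_ker, hker]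
    exact Ideal.mem_span_singleton_self _

end ArtinianReduction

/-! ### Flat extensions, heights and graded modules of finite length -/

section FlatExtensions

attribute [local instance] algebraMvPolynomial in
lemma flat_mvPolynomial_map (k K : Type*) [Field k] [Field K] [Algebra k K] (σ : Type*) :
    Module.Flat (MvPolynomial σ k) (MvPolynomial σ K) :=
  Module.Flat.isBaseChange k (MvPolynomial σ k) K (MvPolynomial σ K)
    (Algebra.IsPushout.out (R := k) (S := MvPolynomial σ k) (R' := K) (S' := MvPolynomial σ K))

lemma flat_rename_castAdd (k : Type*) [Field k] (c d : ℕ) :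
    (rename (R := k) (Fin.castAdd d : Fin c → Fin (c + d))).toRingHom.Flat := by
  let e : MvPolynomial (Fin (c + d)) k ≃ₐ[k] MvPolynomial (Fin d) (MvPolynomial (Fin c) k) :=
    (renameEquiv k (finSumFinEquiv.symm.trans (Equiv.sumComm _ _))).trans
      (sumAlgEquiv k (Fin d) (Fin c))
  have he : ∀ p, e (rename (Fin.castAdd d) p) = C p := by
    intro p
    have : e.toAlgHom.comp (rename (Fin.castAdd d)) =
        IsScalarTower.toAlgHom k (MvPolynomial (Fin c) k)
          (MvPolynomial (Fin d) (MvPolynomial (Fin c) k)) := by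
      ext i : 1
      simp [e, algebraMap_eq]
    exact DFunLike.congr_fun this p
  let := (rename (R := k) (Fin.castAdd d : Fin c → Fin (c + d))).toRingHom.toAlgebra
  let e' : MvPolynomial (Fin (c + d)) k ≃ₗ[MvPolynomial (Fin c) k]
      MvPolynomial (Fin d) (MvPolynomial (Fin c) k) :=
    { e with
      map_smul' := fun p q => by
        change e (rename (Fin.castAdd d) p * q) = p • e q
        rw [map_mul, he, smul_eq_C_mul] }
  exact Module.Flat.of_linearEquiv e'

attribute [local instance] algebraMvPolynomial in
/-- Heights do not drop under extension of the base field, by going down. -/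
lemma height_le_height_of_map_le {k K : Type u} [Field k] [Field K] [Algebra k K] {n : ℕ}
    {I : Ideal (MvPolynomial (Fin n) k)} {J : Ideal (MvPolynomial (Fin n) K)}
    (h : I.map (MvPolynomial.map (algebraMap k K)) ≤ J) : I.height ≤ J.height := by
  have := flat_mvPolynomial_map k K (Fin n)
  refine Ideal.le_height_of_forall_isPrime fun P hP hJP => ?_
  have h1 := Ideal.height_eq_height_add_of_liesOver_of_hasGoingDown
    (P.under (MvPolynomial (Fin n) k)) P
  rw [h1]
  exact (Ideal.height_mono (Ideal.map_le_iff_le_comap.1 (h.trans hJP))).trans le_self_add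

end FlatExtensions

section VariableIdeals

variable (k : Type u) [Field k] (n : ℕ)

/-- The ideal `(x_0, …, x_{c-1})` of `k[x_0, …, x_{n-1}]`, as the kernel of setting these variables
to zero. -/
noncomputable def firstVarsIdeal (c : ℕ) : Ideal (MvPolynomial (Fin n) k) :=
  RingHom.ker (aeval fun i : Fin n => if i.val < c then 0 else X i :
    MvPolynomial (Fin n) k →ₐ[k] MvPolynomial (Fin n) k)

instance (c : ℕ) : (firstVarsIdeal k n c).IsPrime := RingHom.ker_isPrime _

variable {k n}

lemma X_mem_firstVarsIdeal_iff {c : ℕ} {i : Fin n} : X i ∈ firstVarsIdeal k n c ↔ i.val < c := by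
  rw [firstVarsIdeal, RingHom.mem_ker, aeval_X]
  split_ifs with h <;> simp [h]

lemma firstVarsIdeal_le {c : ℕ} {I : Ideal (MvPolynomial (Fin n) k)}
    (h : ∀ i : Fin n, i.val < c → X i ∈ I) : firstVarsIdeal k n c ≤ I := by
  intro p hp
  let ψ : MvPolynomial (Fin n) k →ₐ[k] MvPolynomial (Fin n) k :=
    aeval fun i : Fin n => if i.val < c then 0 else X i
  have hmk : (Ideal.Quotient.mkₐ k I).comp ψ = Ideal.Quotient.mkₐ k I := by
    ext i : 1
    rw [AlgHom.comp_apply, aeval_X]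
    split_ifs with hi
    · rw [map_zero]
      exact (Ideal.Quotient.eq_zero_iff_mem.2 (h i hi)).symm
    · rfl
  have h1 := DFunLike.congr_fun hmk p
  have hp' : ψ p = 0 := hp
  rw [AlgHom.comp_apply, hp', map_zero] at h1
  exact Ideal.Quotient.eq_zero_iff_mem.1 h1.symm

lemma height_firstVarsIdeal {c : ℕ} (hc : c ≤ n) : (firstVarsIdeal k n c).height = c := by
  apply le_antisymm
  · classical
    let s : Finset (MvPolynomial (Fin n) k) :=
      Finset.univ.image fun i : Fin c => X (Fin.castLE hc i)
    have hs : firstVarsIdeal k n c = Ideal.span s := by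
      apply le_antisymm
      · refine firstVarsIdeal_le fun i hi => Ideal.subset_span ?_
        exact Finset.mem_coe.2 (Finset.mem_image.2 ⟨⟨i, hi⟩, Finset.mem_univ _, rfl⟩)
      · rw [Ideal.span_le]
        intro p hp
        obtain ⟨i, -, rfl⟩ := Finset.mem_image.1 (Finset.mem_coe.1 hp)
        exact X_mem_firstVarsIdeal_iff.2 i.2
    refine (Ideal.height_le_card_of_mem_minimalPrimes_span_finset (s := s) ?_).trans ?_
    · rw [← hs, Ideal.minimalPrimes_eq_subsingleton_self]
      rfl
    · exact_mod_cast Finset.card_image_le.trans_eq (Finset.card_fin c)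
  · induction c with
    | zero => simp
    | succ c ih =>
      have hlt : firstVarsIdeal k n c < firstVarsIdeal k n (c + 1) := by
        refine lt_of_le_of_ne (firstVarsIdeal_le fun i hi => X_mem_firstVarsIdeal_iff.2 (by omega))
          fun h => ?_
        have h1 : X ⟨c, hc⟩ ∈ firstVarsIdeal k n (c + 1) :=
          X_mem_firstVarsIdeal_iff.2 (Nat.lt_succ_self c)
        rw [← h, X_mem_firstVarsIdeal_iff] at h1
        exact lt_irrefl _ h1
      have h2 := Ideal.height_add_one_le_of_lt_of_isPrime hlt
      calc ((c + 1 : ℕ) : ℕ∞) = c + 1 := by push_cast; rfl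
        _ ≤ (firstVarsIdeal k n c).height + 1 := add_le_add (ih (by omega)) le_rfl
        _ ≤ _ := h2

end VariableIdeals

section FiniteLength

variable {k : Type u} [Field k] {n : ℕ} {M : Type u} [AddCommGroup M]
  [Module (MvPolynomial (Fin n) k) M]

namespace DegreeProjections

/-- The degrees occurring in a graded Artinian module are bounded above. -/
lemma exists_forall_proj_eq_zero (G : DegreeProjections k n M)
    [IsArtinian (MvPolynomial (Fin n) k) M] : ∃ N : ℤ, ∀ j, N ≤ j → ∀ m, G.proj j m = 0 := by
  let U : ℕ → Submodule (MvPolynomial (Fin n) k) M := fun d =>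
    { carrier := {m | ∀ j : ℤ, j < d → G.proj j m = 0}
      add_mem' := fun ha hb j hj => by rw [map_add, ha j hj, hb j hj, add_zero]
      zero_mem' := fun j _ => map_zero _
      smul_mem' := fun p m hm j hj => by
        rw [← sum_homogeneousComponent p, Finset.sum_smul, map_sum]
        refine Finset.sum_eq_zero fun e _ => ?_
        have h := G.proj_smul e (j - e) _ m (homogeneousComponent_isHomogeneous e p)
        rw [add_sub_cancel] at h
        rw [h, hm _ (by omega), smul_zero] }
  have hU : Antitone U := fun d e hde m hm j hj => hm j (by omega)
  obtain ⟨N, hN⟩ := IsArtinian.monotone_stabilizes (⟨fun d => OrderDual.toDual (U d),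
    fun d e hde => hU hde⟩ : ℕ →o (Submodule (MvPolynomial (Fin n) k) M)ᵒᵈ)
  have hN' : ∀ e, N ≤ e → U N = U e := fun e he => hN e he
  refine ⟨N, fun j hj m => ?_⟩
  have h1 : G.proj j m ∈ U N := fun i hi => by rw [G.proj_proj, if_neg (by omega)]
  rw [hN' (j + 1).toNat (by omega)] at h1
  have h2 := h1 j (by omega)
  rwa [G.proj_proj, if_pos rfl] at h2

lemma X_pow_smul (G : DegreeProjections k n M) (i : Fin n) (e : ℕ) (j : ℤ) (m : M) :
    (X i : MvPolynomial (Fin n) k) ^ e • G.proj j m =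
      G.proj (e + j) ((X i : MvPolynomial (Fin n) k) ^ e • m) :=
  (G.proj_smul e j _ m (by simpa using (isHomogeneous_X k i).pow e)).symm

end DegreeProjections

/-- A nonzero graded Artinian module has a nonzero element killed by all the variables: any nonzero
element of the largest degree. -/
lemma IsGradedPolyModule.exists_forall_X_smul_eq_zero {𝓜 : ℤ → AddSubgroup M}
    (h : IsGradedPolyModule k n 𝓜) [Nontrivial M] [IsArtinian (MvPolynomial (Fin n) k) M] :
    ∃ m : M, m ≠ 0 ∧ ∀ i : Fin n, (X i : MvPolynomial (Fin n) k) • m = 0 := by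
  obtain ⟨G, -⟩ := h.exists_degreeProjections
  obtain ⟨N, hN⟩ := G.exists_forall_proj_eq_zero
  have hex : ∃ j : ℤ, ∃ m, G.proj j m ≠ 0 := by
    by_contra! hall
    obtain ⟨m, hm⟩ := exists_ne (0 : M)
    obtain ⟨s, hs⟩ := G.exists_sum m
    exact hm (hs ▸ Finset.sum_eq_zero fun j _ => hall j m)
  obtain ⟨j, ⟨m, hm⟩, hj⟩ := Int.exists_greatest_of_bdd
    (P := fun j => ∃ m, G.proj j m ≠ 0) ⟨N, fun j hj => by
      obtain ⟨m, hm⟩ := hj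
      by_contra hlt
      exact hm (hN j (by omega) m)⟩ hex
  refine ⟨G.proj j m, hm, fun i => ?_⟩
  have h1 := G.X_pow_smul i 1 j m
  rw [pow_one] at h1
  rw [h1]
  by_contra h2
  have := hj _ ⟨_, h2⟩
  omega

lemma IsGradedPolyModule.exists_X_pow_mem_annihilator {𝓜 : ℤ → AddSubgroup M}
    (h : IsGradedPolyModule k n 𝓜) [IsArtinian (MvPolynomial (Fin n) k) M]
    [Module.Finite (MvPolynomial (Fin n) k) M] (i : Fin n) :
    ∃ e : ℕ, (X i : MvPolynomial (Fin n) k) ^ e ∈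
      Module.annihilator (MvPolynomial (Fin n) k) M := by
  obtain ⟨G, -⟩ := h.exists_degreeProjections
  obtain ⟨N, hN⟩ := G.exists_forall_proj_eq_zero
  have hnil : IsNilpotent (algebraMap (MvPolynomial (Fin n) k)
      (Module.End (MvPolynomial (Fin n) k) M) (X i)) := by
    rw [Module.End.isNilpotent_iff_of_finite]
    intro m
    obtain ⟨s, hs⟩ := G.exists_sum m
    obtain ⟨b, hb⟩ : ∃ b : ℤ, ∀ j ∈ s, b ≤ j := s.bddBelow
    refine ⟨(N - b).toNat, ?_⟩
    rw [← map_pow, Module.algebraMap_end_apply, ← hs, Finset.smul_sum]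
    refine Finset.sum_eq_zero fun j hj => ?_
    rw [G.X_pow_smul]
    have := hb j hj
    exact hN _ (by omega) _
  obtain ⟨e, he⟩ := hnil
  refine ⟨e, Module.mem_annihilator.2 fun m => ?_⟩
  rw [← map_pow] at he
  exact LinearMap.congr_fun he m

/-- The annihilator of a nonzero module is contained in every ideal that contains the entries of
the matrices of a free resolution. -/
lemma FreeResolution.IsMinimal.annihilator_le {R : Type u} [CommRing R] {M : Type u}
    [AddCommGroup M] [Module R M] {F : FreeResolution R M} {I : Ideal R} (hF : F.IsMinimal I)
    (h0 : F.rank 0 ≠ 0) : Module.annihilator R M ≤ I := by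
  intro a ha
  let j : Fin (F.rank 0) := ⟨0, Nat.pos_of_ne_zero h0⟩
  obtain ⟨w, hw⟩ := (F.exact_aug (a • Pi.single j 1)).1 (by
    rw [map_smul, Module.mem_annihilator.1 ha])
  have := hF.d_apply_mem 0 w j
  rwa [hw, Pi.smul_apply, Pi.single_eq_same, smul_eq_mul, mul_one] at this

end FiniteLength

/-! ### Comparison of the two classes of modules -/

section Comparison

variable {k : Type u} [Field k]

/-- The Betti numbers of a graded Cohen–Macaulay module of codimension `c` are those of a module of
finite length over a polynomial ring in `c` variables. -/
theorem IsCohenMacaulayOfCodim.exists_finite_length {n c : ℕ} {M : Type u} [AddCommGroup M]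
    [Module (MvPolynomial (Fin n) k) M] {𝓜 : ℤ → AddSubgroup M} (hM : IsGradedPolyModule k n 𝓜)
    (hCM : IsCohenMacaulayOfCodim k n M c) :
    ∃ (k' : Type u) (_ : Field k') (M' : Type u) (_ : AddCommGroup M')
      (_ : Module (MvPolynomial (Fin c) k') M') (𝓜' : ℤ → AddSubgroup M'),
      IsGradedPolyModule k' c 𝓜' ∧ Nontrivial M' ∧
        IsFiniteLength (MvPolynomial (Fin c) k') M' ∧
        ∃ β : ℕ → ℕ, HasBettiNumbers k n 𝓜 β ∧ HasBettiNumbers k' c 𝓜' β := by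
  have := hCM.finite
  obtain ⟨F₀⟩ := hM.nonempty_minimalGradedFreeResolution
  have hdimR : ∀ (K : Type u) [Field K], ringKrullDim (MvPolynomial (Fin n) K) = n := by
    intro K _
    rw [ringKrullDim_of_isNoetherianRing, ringKrullDim_eq_zero_of_field, zero_add, Nat.card_fin]
  have hne : Module.annihilator (MvPolynomial (Fin n) k) M ≠ ⊤ := by
    intro h
    have := hCM.height_annihilator
    rw [h, Ideal.height_top] at this
    exact ENat.top_ne_natCast c this
  have hcn : c ≤ n := by
    have := Ideal.height_le_ringKrullDim_of_ne_top hne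
    rw [hCM.height_annihilator, hdimR] at this
    exact_mod_cast this
  obtain ⟨d, rfl⟩ := Nat.exists_eq_add_of_le hcn
  let F := F₀.toFreeResolution
  have hF : F.IsMinimal (idealOfVars (Fin (c + d)) k) := F₀.isMinimal
  have hdeg : F.IsHomogeneous F₀.deg := F₀.d_homogeneous
  have h0 : F.rank 0 ≠ 0 := by
    intro h
    have := F.subsingleton_of_rank_eq_zero h
    exact hne (Module.annihilator_eq_top_iff.2 this)
  have hc : F.rank (c + 1) = 0 := by
    refine FreeResolution.IsMinimal.rank_eq_zero_of_hasProjectiveDimensionLT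
      isMaximal_idealOfVars.ne_top (c + 1) hF ?_
    exact (projectiveDimension_le_iff _ c).1 hCM.projectiveDimension_eq.le
  -- pass to an infinite field
  let K := AlgebraicClosure k
  let φ : MvPolynomial (Fin (c + d)) k →+* MvPolynomial (Fin (c + d)) K :=
    MvPolynomial.map (algebraMap k K)
  have hex : F.IsExactMap φ := by
    let := algebraMvPolynomial (σ := Fin (c + d)) (R := k) (S := K)
    have := flat_mvPolynomial_map k K (Fin (c + d))
    exact F.isExactMap_of_flat
  obtain ⟨-, -, hmin, hdeg', -⟩ := FreeResolution.exists_graded_map hF hdeg φ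
    (fun p e hp => hp.map _) hex
  have hht := height_le_height_of_map_le (F.map_annihilator_le φ)
  rw [hCM.height_annihilator] at hht
  obtain ⟨M', _, _, 𝓜', hgr, hnt, hfl, hβ⟩ := FreeResolution.exists_finite_length c d hmin hdeg' hc h0
    (ringKrullDim_quotient_le_of_le_height hht (hdimR K).le le_rfl)
  exact ⟨K, inferInstance, M', inferInstance, inferInstance, 𝓜', hgr, hnt, hfl, F.rank,
    F₀.hasBettiNumbers, hβ⟩

/-- Adjoining variables to a nonzero graded module of finite length over `k[x_0, …, x_{c-1}]` gives
a Cohen–Macaulay module of codimension `c` with the same Betti numbers. -/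
theorem IsGradedPolyModule.exists_cohenMacaulay {c d : ℕ} {M : Type u} [AddCommGroup M]
    [Module (MvPolynomial (Fin c) k) M] {𝓜 : ℤ → AddSubgroup M} (hM : IsGradedPolyModule k c 𝓜)
    [Nontrivial M] (hfl : IsFiniteLength (MvPolynomial (Fin c) k) M) {β : ℕ → ℕ}
    (hβ : HasBettiNumbers k c 𝓜 β) :
    ∃ (N : Type u) (_ : AddCommGroup N) (_ : Module (MvPolynomial (Fin (c + d)) k) N)
      (𝓝 : ℤ → AddSubgroup N), IsGradedPolyModule k (c + d) 𝓝 ∧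
        IsCohenMacaulayOfCodim k (c + d) N c ∧ HasBettiNumbers k (c + d) 𝓝 β := by
  obtain ⟨_, _⟩ := isFiniteLength_iff_isNoetherian_isArtinian.1 hfl
  obtain ⟨⟨F₀⟩, hrank⟩ := hβ
  obtain rfl : F₀.rank = β := funext (hrank F₀)
  let F := F₀.toFreeResolution
  have hF : F.IsMinimal (idealOfVars (Fin c) k) := F₀.isMinimal
  have hdeg : F.IsHomogeneous F₀.deg := F₀.d_homogeneous
  have hlen : ∀ i, c + 1 ≤ i → F.rank i = 0 := fun i hi =>
    hF.rank_eq_zero_of_le isMaximal_idealOfVars.ne_top (hF.rank_succ_eq_zero c) hi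
  have hc : F.rank c ≠ 0 := by
    intro h
    obtain ⟨m, hm, hX⟩ := hM.exists_forall_X_smul_eq_zero
    exact hm (F.eq_zero_of_forall_X_smul_eq_zero c h m hX)
  have h0 : F.rank 0 ≠ 0 := fun h =>
    hc (hF.rank_eq_zero_of_le isMaximal_idealOfVars.ne_top h (Nat.zero_le c))
  let φ : MvPolynomial (Fin c) k →+* MvPolynomial (Fin (c + d)) k :=
    (rename (Fin.castAdd d)).toRingHom
  have hφX : ∀ i, φ (X i) = X (Fin.castAdd d i) := fun i => rename_X _ _
  have hex : F.IsExactMap φ := by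
    let := φ.toAlgebra
    have : Module.Flat (MvPolynomial (Fin c) k) (MvPolynomial (Fin (c + d)) k) :=
      flat_rename_castAdd k c d
    exact F.isExactMap_of_flat
  obtain ⟨𝓝, hgr, hmin, -, hbetti⟩ := FreeResolution.exists_graded_map hF hdeg φ
    (fun p e hp => hp.rename_isHomogeneous) hex
  have hmin' : (F.map φ hex).IsMinimal (firstVarsIdeal k (c + d) c) := by
    refine hF.map hex ?_
    rw [idealOfVars, Ideal.span_le]
    rintro _ ⟨i, rfl⟩
    rw [SetLike.mem_coe, Ideal.mem_comap, hφX]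
    exact X_mem_firstVarsIdeal_iff.2 i.2
  refine ⟨_, _, _, 𝓝, hgr, ⟨(F.map φ hex).finite, ?_, ?_⟩, hbetti⟩
  · apply le_antisymm
    · rw [← height_firstVarsIdeal (k := k) (Nat.le_add_right c d)]
      exact Ideal.height_mono (hmin'.annihilator_le h0)
    · refine Ideal.le_height_of_forall_isPrime fun P hP hle => ?_
      rw [← height_firstVarsIdeal (k := k) (Nat.le_add_right c d)]
      refine Ideal.height_mono (firstVarsIdeal_le fun i hi => ?_)
      obtain ⟨e, he⟩ := hM.exists_X_pow_mem_annihilator ⟨i, hi⟩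
      have h1 := hle (F.map_annihilator_le φ (Ideal.mem_map_of_mem φ he))
      rw [map_pow, hφX] at h1
      exact hP.mem_of_pow_mem _ h1
  · apply le_antisymm
    · exact (projectiveDimension_le_iff _ c).2 ((F.map φ hex).hasProjectiveDimensionLT (c + 1) hlen)
    · refine (projectiveDimension_ge_iff _ c).2 fun h => hc ?_
      exact hmin.rank_eq_zero_of_hasProjectiveDimensionLT isMaximal_idealOfVars.ne_top c h

end Comparison

theorem mainTheorem3 :
    (∀ (k : Type u) [Field k] (n c : ℕ) (M : Type u) [AddCommGroup M]
      [Module (MvPolynomial (Fin n) k) M] (𝓜 : ℤ → AddSubgroup M),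
      IsGradedPolyModule k n 𝓜 → IsCohenMacaulayOfCodim k n M c →
      ∃ (k' : Type u) (_ : Field k') (M' : Type u) (_ : AddCommGroup M')
        (_ : Module (MvPolynomial (Fin c) k') M') (𝓜' : ℤ → AddSubgroup M'),
        IsGradedPolyModule k' c 𝓜' ∧ Nontrivial M' ∧
          IsFiniteLength (MvPolynomial (Fin c) k') M' ∧
          ∃ β : ℕ → ℕ, HasBettiNumbers k n 𝓜 β ∧ HasBettiNumbers k' c 𝓜' β) ∧
    (∀ n c : ℕ, c ≤ n →
      cohenMacaulayBettiSequences.{u} n c = finiteLengthBettiSequences.{u} c) := by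
  refine ⟨fun k _ n c M _ _ 𝓜 hM hCM => hCM.exists_finite_length hM, fun n c hcn => ?_⟩
  obtain ⟨d, rfl⟩ := Nat.exists_eq_add_of_le hcn
  ext β
  constructor
  · rintro ⟨k, _, M, _, _, 𝓜, hM, hCM, hβ⟩
    obtain ⟨k', _, M', _, _, 𝓜', hgr, hnt, hfl, β', hβ', hβ''⟩ := hCM.exists_finite_length hM
    obtain ⟨F⟩ := hβ.1
    obtain rfl : β = β' := funext fun i => (hβ.2 F i).symm.trans (hβ'.2 F i)
    exact ⟨k', _, M', _, _, 𝓜', hgr, hnt, hfl, hβ''⟩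
  · rintro ⟨k, _, M, _, _, 𝓜, hM, hnt, hfl, hβ⟩
    obtain ⟨N, _, _, 𝓝, hgr, hCM, hβ'⟩ := hM.exists_cohenMacaulay (d := d) hfl hβ
    exact ⟨k, _, N, _, _, 𝓝, hgr, hCM, hβ'⟩
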